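/- Let $I_1,I_2,I_3\in(-1,+\infty)$ satisfy the structure condition $$I_1+I_2I_3\ge 0,\qquad I_2+I_1I_3\ge 0,\qquad I_3+I_1I_2\ge 0,$$ where $I_i=I_{jk}$ ($\{i,j,k\}=\{1,2,3\}$) is the weight of the edge $\{jk\}$ of a triangle $\{123\}$. For $r=(r_1,r_2,r_3)\in\mathbb{R}^3_{>0}$ define the edge lengths $$l_{jk}=\cosh^{-1}\bigl(\cosh r_j\cosh r_k+I_{i}\sinh r_j\sinh r_k\bigr),\qquad \{i,j,k\}=\{1,2,3\}.$$ Call $r$ a nondegenerate hyperbolic inversive distance circle packing metric if there is a nondegenerate triangle (its three vertices not on a common geodesic) in the hyperbolic plane $\mathbb{H}^2$ with edge lengths $l_{12},l_{13},l_{23}$; in that case let $\theta_i$ be the inner angle of this triangle at the vertex $i$. Put $u_i=\ln\tanh\frac{r_i}{2}$ and regard $\theta_1,\theta_2,\theta_3$ as functions of $(u_1,u_2,u_3)$, with the weights fixed. Then at every nondegenerate hyperbolic inversive distance circle packing metric $r$, the map $(u_1,u_2,u_3)\mapsto(\theta_1,\theta_2,\theta_3)$ is differentiable, and its Jacobian matrix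 $$\Lambda^H_{123}=\frac{\partial(\theta_1,\theta_2,\theta_3)}{\partial(u_1,u_2,u_3)}$$ is (symmetric and) negative definite. -/

import Mathlib

namespace HypInversive

noncomputable section

open UpperHalfPlane

/-! Conventions. The vertices of the triangle are `0, 1, 2 : Fin 3`, and addition of indices is
cyclic, so that `i`, `i + 1`, `i + 2` are always the three vertices. A function on the edges is
indexed by the opposite vertex: `I i` is the weight of the edge joining `i + 1` and `i + 2`. The
hyperbolic plane is the upper half-plane `ℍ` with Mathlib's (curvature `-1`) distance. -/

/-- A geodesic line of the hyperbolic plane: a vertical half-line, or a half-circle centred on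
the real axis. -/
def IsGeodesicLine (L : Set ℍ) : Prop :=
  (∃ c : ℝ, L = {z : ℍ | z.re = c}) ∨
    ∃ c R : ℝ, 0 < R ∧ L = {z : ℍ | (z.re - c) ^ 2 + z.im ^ 2 = R ^ 2}

/-- The three vertices lie on no common geodesic line. -/
def IsNondegenerate (T : Fin 3 → ℍ) : Prop :=
  ∀ L : Set ℍ, IsGeodesicLine L → ¬ ∀ i, T i ∈ L

/-- The point `q` in the Poincaré disc model in which `p` is the centre. The map
`q ↦ (q - p) / (q - conj p)` is a conformal isometry of `ℍ` onto the disc that takes `p` to `0`,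
so it takes the geodesic rays issuing from `p` to the Euclidean radii. -/
def toDisc (p q : ℍ) : ℂ :=
  ((q : ℂ) - (p : ℂ)) / ((q : ℂ) - (starRingEnd ℂ) (p : ℂ))

/-- The hyperbolic angle at `p` between the geodesic rays from `p` to `q` and from `p` to `s`
(for `q` and `s` distinct from `p`). -/
def hypAngle (p q s : ℍ) : ℝ :=
  InnerProductGeometry.angle (toDisc p q) (toDisc p s)

/-- The structure condition on the three weights. -/
def StructureCondition (I : Fin 3 → ℝ) : Prop :=
  ∀ i, 0 ≤ I i + I (i + 1) * I (i + 2)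

/-- The length of the edge opposite to the vertex `i`, for weights `I` and radii `r`. -/
def edgeLength (I r : Fin 3 → ℝ) (i : Fin 3) : ℝ :=
  Real.arcosh (Real.cosh (r (i + 1)) * Real.cosh (r (i + 2))
    + I i * Real.sinh (r (i + 1)) * Real.sinh (r (i + 2)))

/-- `T` is a nondegenerate hyperbolic triangle with the edge lengths given by `I` and `r`. -/
def Realizes (I r : Fin 3 → ℝ) (T : Fin 3 → ℍ) : Prop :=
  (∀ i, dist (T (i + 1)) (T (i + 2)) = edgeLength I r i) ∧ IsNondegenerate T

/-- The nondegenerate hyperbolic inversive distance circle packing metrics of the triangle with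
weights `I`. -/
def admissibleSpace (I : Fin 3 → ℝ) : Set (Fin 3 → ℝ) :=
  {r | (∀ i, 0 < r i) ∧ ∃ T, Realizes I r T}

open Classical in
/-- The inner angle `θ i` at the vertex `i`, as a function of the radii: the angle at `i` of a
hyperbolic triangle with the prescribed edge lengths, and `0` if there is no such triangle. It does
not depend on the triangle that is chosen, see `innerAngle_eq`. -/
def innerAngle (I r : Fin 3 → ℝ) (i : Fin 3) : ℝ :=
  if h : ∃ T, Realizes I r T then
    hypAngle (h.choose i) (h.choose (i + 1)) (h.choose (i + 2))
  else 0

/-- The coordinates `u i = log (tanh (r i / 2))`. -/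
def uCoord (r : Fin 3 → ℝ) : Fin 3 → ℝ := fun i => Real.log (Real.tanh (r i / 2))

/-- The radii as functions of the coordinates `u`. -/
def radii (u : Fin 3 → ℝ) : Fin 3 → ℝ := fun i => 2 * Real.artanh (Real.exp (u i))

/-- The inner angles as functions of the coordinates `u`. -/
def angleMap (I : Fin 3 → ℝ) (u : Fin 3 → ℝ) : Fin 3 → ℝ := innerAngle I (radii u)

/-- The Jacobian matrix `∂(θ 0, θ 1, θ 2) / ∂(u 0, u 1, u 2)` at the radii `r`. -/
def angleJacobian (I r : Fin 3 → ℝ) : Matrix (Fin 3) (Fin 3) ℝ :=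
  LinearMap.toMatrix' (fderiv ℝ (angleMap I) (uCoord r) : (Fin 3 → ℝ) →ₗ[ℝ] (Fin 3 → ℝ))

theorem radii_uCoord (r : Fin 3 → ℝ) (hr : ∀ i, 0 < r i) : radii (uCoord r) = r := by
  funext i
  have h : 0 < Real.tanh (r i / 2) := by
    rw [Real.tanh_eq_sinh_div_cosh]
    exact div_pos (Real.sinh_pos_iff.2 (by linarith [hr i])) (Real.cosh_pos _)
  simp only [radii, uCoord, Real.exp_log h, Real.artanh_tanh]
  ring

/-- A positive multiple of `toDisc p q` whose norm is `sinh (dist p q)`. -/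
theorem toDisc_eq_smul (p q : ℍ) : ∃ (c : ℝ) (v : ℂ), 0 < c ∧ toDisc p q = c • v ∧
    ‖v‖ = Real.sinh (dist p q) ∧
    v.re = ((q.re - p.re) ^ 2 + q.im ^ 2 - p.im ^ 2) / (2 * p.im * q.im) ∧
    v.im = -(q.re - p.re) / q.im := by
  have hp := p.im_pos
  have hq := q.im_pos
  have hD : 0 < (q.re - p.re) ^ 2 + (q.im + p.im) ^ 2 := by positivity
  refine ⟨2 * p.im * q.im / ((q.re - p.re) ^ 2 + (q.im + p.im) ^ 2),
    ⟨((q.re - p.re) ^ 2 + q.im ^ 2 - p.im ^ 2) / (2 * p.im * q.im), -(q.re - p.re) / q.im⟩,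
    by positivity, ?_, ?_, rfl, rfl⟩
  · have hne : (q : ℂ) - (starRingEnd ℂ) (p : ℂ) ≠ 0 := by
      intro h
      have := congrArg Complex.im h
      simp at this
      linarith
    rw [toDisc, div_eq_iff hne, Complex.real_smul, mul_assoc]
    apply Complex.ext
    · rw [Complex.re_ofReal_mul]
      simp
      field_simp
      ring
    · rw [Complex.im_ofReal_mul]
      simp
      field_simp
      ring
  · have h0 : 0 ≤ Real.sinh (dist p q) := Real.sinh_nonneg_iff.2 dist_nonneg
    rw [← abs_of_nonneg h0, ← abs_of_nonneg (norm_nonneg _), ← sq_eq_sq_iff_abs_eq_abs,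
      Complex.sq_norm, Complex.normSq_mk, Real.sinh_sq, cosh_dist']
    field_simp
    ring

/-- The hyperbolic law of cosines. -/
theorem cos_hypAngle (p q s : ℍ) :
    Real.sinh (dist p q) * Real.sinh (dist p s) * Real.cos (hypAngle p q s) =
      Real.cosh (dist p q) * Real.cosh (dist p s) - Real.cosh (dist q s) := by
  obtain ⟨c, v, hc, hcv, hv, hvr, hvi⟩ := toDisc_eq_smul p q
  obtain ⟨d, w, hd, hdw, hw, hwr, hwi⟩ := toDisc_eq_smul p s
  have hp := p.im_pos
  have hq := q.im_pos
  have hs := s.im_pos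
  rw [hypAngle, hcv, hdw, InnerProductGeometry.angle_smul_left_of_pos _ _ hc,
    InnerProductGeometry.angle_smul_right_of_pos _ _ hd, ← hv, ← hw, mul_comm,
    InnerProductGeometry.cos_angle_mul_norm_mul_norm, Complex.inner]
  simp only [Complex.mul_re, Complex.conj_re, Complex.conj_im, hvr, hvi, hwr, hwi, cosh_dist']
  field_simp
  ring

theorem ne_of_isNondegenerate (T : Fin 3 → ℍ) (h : IsNondegenerate T) (i : Fin 3) :
    T i ≠ T (i + 1) ∧ T i ≠ T (i + 2) := by
  have key : ∀ a b : ℍ, ∃ L, IsGeodesicLine L ∧ a ∈ L ∧ b ∈ L := by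
    intro a b
    have ha := a.im_pos
    by_cases hab : a.re = b.re
    · exact ⟨_, Or.inl ⟨a.re, rfl⟩, rfl, hab.symm⟩
    · have hne : a.re - b.re ≠ 0 := sub_ne_zero.2 hab
      set c : ℝ := (a.re ^ 2 + a.im ^ 2 - b.re ^ 2 - b.im ^ 2) / (2 * (a.re - b.re)) with hc
      have hpos : 0 < (a.re - c) ^ 2 + a.im ^ 2 := by positivity
      refine ⟨_, Or.inr ⟨c, √((a.re - c) ^ 2 + a.im ^ 2), Real.sqrt_pos.2 hpos, rfl⟩, ?_, ?_⟩
      · simp only [Set.mem_ofPred_eq, Real.sq_sqrt hpos.le]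
      · simp only [Set.mem_ofPred_eq, Real.sq_sqrt hpos.le]
        have : c * (2 * (a.re - b.re)) = a.re ^ 2 + a.im ^ 2 - b.re ^ 2 - b.im ^ 2 := by
          rw [hc]
          field_simp
        linarith
  have hj : ∀ j : Fin 3, j = i ∨ j = i + 1 ∨ j = i + 2 := by
    revert i
    decide
  constructor
  · intro he
    obtain ⟨L, hL, h1, h2⟩ := key (T i) (T (i + 2))
    refine h L hL fun j => ?_
    rcases hj j with rfl | rfl | rfl
    · exact h1
    · exact he ▸ h1
    · exact h2
  · intro he
    obtain ⟨L, hL, h1, h2⟩ := key (T i) (T (i + 1))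
    refine h L hL fun j => ?_
    rcases hj j with rfl | rfl | rfl
    · exact h1
    · exact h2
    · exact he ▸ h1

/-- The inner angle is the angle of every triangle that has the prescribed edge lengths. -/
theorem innerAngle_eq (I r : Fin 3 → ℝ) (T : Fin 3 → ℍ) (hT : Realizes I r T) (i : Fin 3) :
    innerAngle I r i = hypAngle (T i) (T (i + 1)) (T (i + 2)) := by
  have hex : ∃ T, Realizes I r T := ⟨T, hT⟩
  have hd : ∀ S : Fin 3 → ℍ, Realizes I r S →
      dist (S i) (S (i + 1)) = edgeLength I r (i + 2) ∧
      dist (S i) (S (i + 2)) = edgeLength I r (i + 1) ∧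
      dist (S (i + 1)) (S (i + 2)) = edgeLength I r i := by
    intro S hS
    have e : i + 2 + 1 = i ∧ i + 2 + 2 = i + 1 ∧ i + 1 + 1 = i + 2 ∧ i + 1 + 2 = i := by
      revert i
      decide
    have h1 := hS.1 (i + 2)
    have h2 := hS.1 (i + 1)
    rw [e.1, e.2.1] at h1
    rw [e.2.2.1, e.2.2.2, dist_comm] at h2
    exact ⟨h1, h2, hS.1 i⟩
  rw [innerAngle, dif_pos hex]
  set S := hex.choose with hSdef
  have hS : Realizes I r S := hex.choose_spec
  have c1 := cos_hypAngle (S i) (S (i + 1)) (S (i + 2))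
  have c2 := cos_hypAngle (T i) (T (i + 1)) (T (i + 2))
  obtain ⟨s1, s2, s3⟩ := hd S hS
  obtain ⟨t1, t2, t3⟩ := hd T hT
  obtain ⟨n1, n2⟩ := ne_of_isNondegenerate T hT.2 i
  have p1 : 0 < Real.sinh (dist (T i) (T (i + 1))) := Real.sinh_pos_iff.2 (dist_pos.2 n1)
  have p2 : 0 < Real.sinh (dist (T i) (T (i + 2))) := Real.sinh_pos_iff.2 (dist_pos.2 n2)
  rw [s1, s2, s3] at c1
  rw [t1, t2, t3] at c2
  rw [t1] at p1
  rw [t2] at p2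
  refine Real.injOn_cos
    ⟨InnerProductGeometry.angle_nonneg _ _, InnerProductGeometry.angle_le_pi _ _⟩
    ⟨InnerProductGeometry.angle_nonneg _ _, InnerProductGeometry.angle_le_pi _ _⟩ ?_
  exact mul_left_cancel₀ (mul_pos p1 p2).ne' (c1.trans c2.symm)

end

end HypInversive

/-! Place the triangle on the hyperboloid as unit timelike vectors `v₁, v₂, v₃` with products `-Cᵢ`,
where `Cᵢ` is the hyperbolic cosine of an edge; nondegeneracy becomes `gramDet > 0`. Differentiating
the law of cosines shows that the Jacobian is `-(gramDet)^(-1/2)` times the symmetric matrix of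
`triForm` with coefficients `wᵢ / (Cᵢ² - 1)`, where `w` (`powerCoord`) consists of scaled
barycentric coordinates of the power centre. It remains to prove this form positive definite,
although a `wᵢ` may be negative.

The determinant is positive (`detPoly_pos`): its sign is that of the determinant of `∂C/∂u`, which
the structure condition makes a sum of nonnegative terms and a positive one (`edgeDet_pos`). The
structure condition also allows at most one negative `wᵢ` (`powerCoord_nonneg`), say `w₁`. By the
determinant bound the leading minor of size two then cannot vanish (`minorPoly_ne_zero`), so its
sign is constant along deformations keeping `gramDet > 0` and `w₂, w₃ ≥ 0`. If the power centre is
timelike or lightlike, the minor is positive by a direct estimate (`edge_inequality`). Otherwise the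
radii are deformed until it is (`minorPoly_pos_of_neg`), and the sign is carried back. -/

namespace HypInversive

/-! ### Lorentzian estimates and the ternary form -/

/-- The Gram determinant `1 + 2xyz - x² - y² - z²` of three unit timelike vectors with pairwise
products `-x`, `-y`, `-z`. -/
def gramDet (x y z : ℝ) : ℝ := 1 + 2 * x * y * z - x ^ 2 - y ^ 2 - z ^ 2

/-- The quadratic form `∑ xᵢ (Cᵢ (yⱼ² + yₖ²) - 2 yⱼ yₖ)`. -/
def triForm (C1 C2 C3 x1 x2 x3 y1 y2 y3 : ℝ) : ℝ :=
  x1 * (C1 * (y2 ^ 2 + y3 ^ 2) - 2 * y2 * y3) + x2 * (C2 * (y3 ^ 2 + y1 ^ 2) - 2 * y3 * y1) +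
    x3 * (C3 * (y1 ^ 2 + y2 ^ 2) - 2 * y1 * y2)

/-- The difference of the two sides of the edge inequality in the extremal case `m = X - s`. Since
`(X - s)(X + s) = 1`, `s` times the bracket splits into `p(Y² + s²)/2 - qYs`, nonnegative because
`|q| ≤ p`, and a multiple of `s² - Y²`. -/
theorem foot_residual_nonneg {k p q X Y s : ℝ} (hk : 0 ≤ k) (hp : 0 < p) (hX : 0 < X)
    (hs : 0 ≤ s) (hpq : p ^ 2 - q ^ 2 = 1) (hsX : s ^ 2 = X ^ 2 - 1) (hY : Y ^ 2 ≤ s ^ 2) :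
    0 ≤ k * X * (p * (X - s) * Y ^ 2 - q * Y + p * (X - s) * s * X) +
      p * (X - s) * s ^ 2 * (p * s - q * Y) := by
  have hm : 0 < X - s := by nlinarith
  have hqY : q * Y ≤ p * s := by
    have h1 : (q * Y) ^ 2 ≤ (p * s) ^ 2 := by nlinarith [sq_nonneg Y, sq_nonneg s]
    exact abs_le_of_sq_le_sq h1 (by positivity) |> fun h => (abs_le.1 h).2
  have hmain : 0 ≤ p * (X - s) * Y ^ 2 - q * Y + p * (X - s) * s * X := by
    rcases hs.eq_or_lt with h0 | h0
    · have : Y = 0 := by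
        rw [← h0] at hY
        nlinarith
      rw [← h0, this]
      simp
    · have e : s * (p * (X - s) * Y ^ 2 - q * Y + p * (X - s) * s * X) =
          (p * (Y ^ 2 + s ^ 2) / 2 - q * Y * s) + p * (X - s) ^ 2 * (s ^ 2 - Y ^ 2) / 2 := by
        have h1 : (X - s) * (X + s) = 1 := by linarith
        have h2 : 2 * ((X - s) * s) = 1 - (X - s) ^ 2 := by linarith
        have h3 : 2 * ((X - s) * X) = 1 + (X - s) ^ 2 := by linarith
        linear_combination p * Y ^ 2 / 2 * h2 + p * s ^ 2 / 2 * h3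
      have h4 : 0 ≤ p * (Y ^ 2 + s ^ 2) / 2 - q * Y * s := by
        have h5 : |q| ≤ p := abs_le_of_sq_le_sq (by linarith) hp.le
        have h6 := abs_le.1 h5
        nlinarith [mul_nonneg (by linarith : 0 ≤ p - q) (sq_nonneg (Y + s)),
          mul_nonneg (by linarith : 0 ≤ p + q) (sq_nonneg (Y - s))]
      have h7 : 0 ≤ p * (X - s) ^ 2 * (s ^ 2 - Y ^ 2) / 2 := by
        have := sub_nonneg.2 hY
        positivity
      refine nonneg_of_mul_nonneg_right ?_ h0
      rw [e]
      linarith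
  have := sub_nonneg.2 hqY
  positivity

/-- A point of the light cone over the edge with foot `a v₂ + b v₃`, normalised. -/
theorem edge_inequality_of_normalized {C1 C2 C3 a b m s : ℝ} (h1 : 1 < C1) (h2 : 1 < C2)
    (h3 : 1 < C3) (hA : 0 < gramDet C1 C2 C3) (ha : 0 ≤ a) (hb : 0 ≤ b)
    (hn : a ^ 2 + b ^ 2 + 2 * a * b * C1 = 1) (hs : 0 ≤ s)
    (hsX : s ^ 2 = (a * C3 + b * C2) ^ 2 - 1) (hm : m ≤ a * C3 + b * C2 - s) :
    m * (C2 * C3 * (a * C3 + b * C2) - a * C2 - b * C3) * (2 * a * b + C1 * (a ^ 2 + b ^ 2)) ≤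
      (a * C3 + b * C2) * (b * C2 * (a + b * C1) ^ 2 + a * C3 * (a * C1 + b) ^ 2) -
        (2 * a * b + C1 * (a ^ 2 + b ^ 2)) ^ 2 := by
  have hX0 : 0 < a * C3 + b * C2 := by
    rcases ha.eq_or_lt with h | h
    · have : b ≠ 0 := by
        rintro rfl
        rw [← h] at hn
        norm_num at hn
      have : 0 < b := lt_of_le_of_ne hb this.symm
      rw [← h]
      nlinarith
    · have := mul_pos h (by linarith : 0 < C3)
      have := mul_nonneg hb (by linarith : 0 ≤ C2)
      linarith
  have hp0 : 0 < 2 * a * b + C1 * (a ^ 2 + b ^ 2) := by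
    have e : 1 ≤ C1 * (2 * a * b + C1 * (a ^ 2 + b ^ 2)) := by
      have : 0 ≤ (C1 ^ 2 - 1) * (a ^ 2 + b ^ 2) := mul_nonneg (by nlinarith) (by positivity)
      linarith
    exact pos_of_mul_pos_right (by linarith) (by linarith : 0 ≤ C1)
  have hB : 0 ≤ C2 * C3 * (a * C3 + b * C2) - a * C2 - b * C3 := by
    have e2 : 0 ≤ C3 ^ 2 - 1 := by nlinarith
    have e3 : 0 ≤ C2 ^ 2 - 1 := by nlinarith
    have : C2 * C3 * (a * C3 + b * C2) - a * C2 - b * C3 =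
      a * C2 * (C3 ^ 2 - 1) + b * C3 * (C2 ^ 2 - 1) := by ring
    rw [this]
    positivity
  obtain ⟨S, hS, hS2⟩ : ∃ S : ℝ, 0 < S ∧ S ^ 2 = C1 ^ 2 - 1 :=
    ⟨√(C1 ^ 2 - 1), Real.sqrt_pos.2 (by nlinarith), Real.sq_sqrt (by nlinarith)⟩
  -- `X = a C3 + b C2` and `Y` are the coordinates of `v₁`, up to sign, along the foot and
  -- orthogonal to it within the plane of the edge. The remaining squared component of `v₁` is `s² -
  -- Y² = gramDet / S²`.
  obtain ⟨Y, hYS⟩ : ∃ Y, S * Y = (a * C1 + b) * C3 - (a + b * C1) * C2 :=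
    ⟨((a * C1 + b) * C3 - (a + b * C1) * C2) / S, by field_simp⟩
  have hC3 : C3 = (a + b * C1) * (a * C3 + b * C2) + b * S * Y := by
    linear_combination (-C3) * hn - b * hYS
  have hC2 : C2 = (a * C1 + b) * (a * C3 + b * C2) - a * S * Y := by
    linear_combination (-C2) * hn + a * hYS
  have hY : Y ^ 2 ≤ s ^ 2 := by
    have : S ^ 2 * (s ^ 2 - Y ^ 2) = gramDet C1 C2 C3 := by
      rw [mul_sub, ← mul_pow S Y, hYS, hsX, hS2, gramDet]
      linear_combination (2 * C1 * C2 * C3 - C2 ^ 2 - C3 ^ 2) * hn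
    have h0 : 0 < S ^ 2 * (s ^ 2 - Y ^ 2) := this ▸ hA
    have := pos_of_mul_pos_right h0 (sq_nonneg S)
    linarith
  have hres := foot_residual_nonneg (k := a * b * S ^ 2) (q := S * (b ^ 2 - a ^ 2))
    (by positivity) hp0 hX0 hs
    (by rw [mul_pow, hS2]
        linear_combination (a ^ 2 + b ^ 2 + 2 * a * b * C1 + 1) * hn) hsX hY
  -- The coefficient of `m` is nonnegative, so the worst case is the light cone value `m = X - s`.
  refine (mul_le_mul_of_nonneg_right (mul_le_mul_of_nonneg_right hm hB) hp0.le).trans ?_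
  rw [← sub_nonneg]
  generalize hXdef : a * C3 + b * C2 = X at *
  have eB : C2 * C3 * X - a * C2 - b * C3 = (a + b * C1) * (a * C1 + b) * X ^ 3 +
      S * (b ^ 2 - a ^ 2) * X ^ 2 * Y - a * b * S ^ 2 * X * Y ^ 2 -
      (2 * a * b + C1 * (a ^ 2 + b ^ 2)) * X - S * (b ^ 2 - a ^ 2) * Y := by
    rw [hC3, hC2]
    ring
  have eR : b * C2 * (a + b * C1) ^ 2 + a * C3 * (a * C1 + b) ^ 2 =
      (a + b * C1) * (a * C1 + b) * (2 * a * b + C1 * (a ^ 2 + b ^ 2)) * X -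
        a * b * S ^ 2 * (S * (b ^ 2 - a ^ 2)) * Y := by
    have e : a * b * S ^ 2 * (S * (b ^ 2 - a ^ 2)) * Y =
      a * b * (C1 ^ 2 - 1) * (S * (b ^ 2 - a ^ 2)) * Y := by rw [hS2]
    rw [e, hC3, hC2]
    ring
  rw [eB, eR]
  refine le_of_le_of_eq hres ?_
  have hg : (a + b * C1) * (a * C1 + b) =
      2 * a * b + C1 * (a ^ 2 + b ^ 2) + a * b * S ^ 2 := by
    rw [hS2]
    ring
  rw [hg]
  generalize 2 * a * b + C1 * (a ^ 2 + b ^ 2) = p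
  generalize S * (b ^ 2 - a ^ 2) = q
  generalize a * b * S ^ 2 = k
  have hX3 : X ^ 2 = s ^ 2 + 1 := by linarith
  grind


/-- Both sides are homogeneous of degree four in `(a, b, m)`, so `a v₂ + b v₃` can be scaled to unit
length. The second alternative in `hm` puts `a v₂ + b v₃ - m v₁` in the closed cone of the foot,
which bounds `m` by the smaller root `X - s` of the quadratic. -/
theorem edge_inequality {C1 C2 C3 a b m : ℝ} (h1 : 1 < C1) (h2 : 1 < C2)
    (h3 : 1 < C3) (hA : 0 < gramDet C1 C2 C3) (ha : 0 ≤ a) (hb : 0 ≤ b)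
    (hm : m ≤ 0 ∨ m ≤ a * C3 + b * C2 ∧
      0 ≤ m ^ 2 + (a ^ 2 + b ^ 2 + 2 * a * b * C1) - 2 * m * (a * C3 + b * C2)) :
    m * (C2 * C3 * (a * C3 + b * C2) - a * C2 - b * C3) * (2 * a * b + C1 * (a ^ 2 + b ^ 2)) ≤
      (a * C3 + b * C2) * (b * C2 * (a + b * C1) ^ 2 + a * C3 * (a * C1 + b) ^ 2) -
        (2 * a * b + C1 * (a ^ 2 + b ^ 2)) ^ 2 := by
  have hab := mul_nonneg ha hb
  have hn0 : 0 ≤ a ^ 2 + b ^ 2 + 2 * a * b * C1 := by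
    have := mul_nonneg hab (by linarith : 0 ≤ C1)
    nlinarith [sq_nonneg a, sq_nonneg b]
  rcases hn0.eq_or_lt with hn | hn
  · have hC : 0 ≤ a * b * C1 := mul_nonneg hab (by linarith)
    have ha0 : a = 0 := by nlinarith [sq_nonneg a, sq_nonneg b]
    have hb0 : b = 0 := by nlinarith [sq_nonneg a, sq_nonneg b]
    simp [ha0, hb0]
  obtain ⟨v, hv, hv2⟩ : ∃ v : ℝ, 0 < v ∧ v ^ 2 = a ^ 2 + b ^ 2 + 2 * a * b * C1 :=
    ⟨_, Real.sqrt_pos.2 hn, Real.sq_sqrt hn.le⟩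
  obtain ⟨a, rfl⟩ : ∃ t, a = v * t := ⟨a / v, by field_simp⟩
  obtain ⟨b, rfl⟩ : ∃ t, b = v * t := ⟨b / v, by field_simp⟩
  obtain ⟨m, rfl⟩ : ∃ t, m = v * t := ⟨m / v, by field_simp⟩
  have ha' : 0 ≤ a := nonneg_of_mul_nonneg_right ha hv
  have hb' : 0 ≤ b := nonneg_of_mul_nonneg_right hb hv
  have hn1 : a ^ 2 + b ^ 2 + 2 * a * b * C1 = 1 := by
    have : v ^ 2 * (a ^ 2 + b ^ 2 + 2 * a * b * C1) = v ^ 2 * 1 := by linarith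
    exact mul_left_cancel₀ (by positivity) this
  have hX0 : 0 ≤ a * C3 + b * C2 :=
    add_nonneg (mul_nonneg ha' (by linarith)) (mul_nonneg hb' (by linarith))
  have hX1 : 0 ≤ (a * C3 + b * C2) ^ 2 - 1 := by
    have e : (C1 ^ 2 - 1) * ((a * C3 + b * C2) ^ 2 - 1) =
        ((a * C1 + b) * C3 - (a + b * C1) * C2) ^ 2 + gramDet C1 C2 C3 := by
      rw [gramDet]
      linear_combination (2 * C1 * C2 * C3 - C2 ^ 2 - C3 ^ 2) * hn1
    refine nonneg_of_mul_nonneg_right (a := C1 ^ 2 - 1) ?_ (by nlinarith)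
    rw [e]
    positivity
  have hs2 := Real.sq_sqrt hX1
  have hs0 := Real.sqrt_nonneg ((a * C3 + b * C2) ^ 2 - 1)
  set s := √((a * C3 + b * C2) ^ 2 - 1)
  have hsX : s ≤ a * C3 + b * C2 := by
    refine (abs_le_of_sq_le_sq ?_ hX0 |> fun h => (abs_le.1 h).2)
    linarith
  have hm' : m ≤ a * C3 + b * C2 - s := by
    rcases hm with hm | ⟨hm, hq⟩
    · have : m ≤ 0 := by
        by_contra! h
        have := mul_pos hv h
        linarith
      linarith
    · have e1 : 0 ≤ a * C3 + b * C2 - m :=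
        nonneg_of_mul_nonneg_right (a := v) (by linarith) hv
      have e2 : 0 ≤ m ^ 2 + 1 - 2 * m * (a * C3 + b * C2) := by
        refine nonneg_of_mul_nonneg_right (a := v ^ 2) ?_ (by positivity)
        rw [← hn1]
        linarith
      have e3 : s ≤ a * C3 + b * C2 - m :=
        (abs_le_of_sq_le_sq (by linarith) e1 |> fun h => (abs_le.1 h).2)
      linarith
  have := edge_inequality_of_normalized h1 h2 h3 hA ha' hb' hn1 hs0 hs2 hm'
  have h4 := mul_le_mul_of_nonneg_left this (by positivity : 0 ≤ v ^ 4)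
  linarith

theorem diag_pos_of_det_pos {C1 C2 C3 x1 x2 x3 : ℝ} (h2 : 1 < C2) (h3 : 1 < C3)
    (hx2 : 0 ≤ x2) (hx3 : 0 ≤ x3)
    (hdet : 0 < 2 * x1 * x2 * x3 * (C1 * C2 * C3 - 1) +
      x1 ^ 2 * (C1 ^ 2 - 1) * (x2 * C2 + x3 * C3) + x2 ^ 2 * (C2 ^ 2 - 1) * (x3 * C3 + x1 * C1) +
      x3 ^ 2 * (C3 ^ 2 - 1) * (x1 * C1 + x2 * C2)) : 0 < x2 * C2 + x3 * C3 := by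
  rcases hx2.eq_or_lt with h | h
  · rcases hx3.eq_or_lt with h' | h'
    · simp [← h, ← h'] at hdet
    · have := mul_pos h' (by linarith : 0 < C3)
      have := mul_nonneg hx2 (by linarith : 0 ≤ C2)
      linarith
  · have := mul_pos h (by linarith : 0 < C2)
    have := mul_nonneg hx3 (by linarith : 0 ≤ C3)
    linarith

/-- Sylvester's criterion by completing squares: `P` is the first diagonal entry, `A` the leading
minor of size two, and `A * B - K ^ 2` is `P` times the determinant. -/
theorem triForm_pos_of_minor {C1 C2 C3 x1 x2 x3 : ℝ} (hP : 0 < x2 * C2 + x3 * C3)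
    (hM : 0 < (x2 * C2 + x3 * C3) * (x1 * C1 + x3 * C3) - x3 ^ 2)
    (hdet : 0 < 2 * x1 * x2 * x3 * (C1 * C2 * C3 - 1) +
      x1 ^ 2 * (C1 ^ 2 - 1) * (x2 * C2 + x3 * C3) + x2 ^ 2 * (C2 ^ 2 - 1) * (x3 * C3 + x1 * C1) +
      x3 ^ 2 * (C3 ^ 2 - 1) * (x1 * C1 + x2 * C2))
    {y1 y2 y3 : ℝ} (hy : ¬ (y1 = 0 ∧ y2 = 0 ∧ y3 = 0)) :
    0 < triForm C1 C2 C3 x1 x2 x3 y1 y2 y3 := by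
  obtain ⟨P, hPd⟩ : ∃ P, P = x2 * C2 + x3 * C3 := ⟨_, rfl⟩
  obtain ⟨A, hAd⟩ : ∃ A, A = P * (x1 * C1 + x3 * C3) - x3 ^ 2 := ⟨_, rfl⟩
  obtain ⟨B, hBd⟩ : ∃ B, B = P * (x1 * C1 + x2 * C2) - x2 ^ 2 := ⟨_, rfl⟩
  obtain ⟨K, hKd⟩ : ∃ K, K = -(P * x1) - x2 * x3 := ⟨_, rfl⟩
  have hABK : 0 < A * B - K ^ 2 := by
    have := mul_pos hP hdet
    rw [hAd, hBd, hKd, hPd]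
    linarith
  rw [← hPd] at hP hM
  have hApos : 0 < A := hAd ▸ hM
  have hsq : A * P * triForm C1 C2 C3 x1 x2 x3 y1 y2 y3 =
      A * (P * y1 - x3 * y2 - x2 * y3) ^ 2 + (A * y2 + K * y3) ^ 2 + (A * B - K ^ 2) * y3 ^ 2 := by
    rw [triForm, hAd, hBd, hKd, hPd]
    ring
  refine pos_of_mul_pos_right (a := A * P) ?_ (mul_pos hApos hP).le
  rw [hsq]
  by_cases h3 : y3 = 0
  · by_cases h2 : y2 = 0
    · have h1 : y1 ≠ 0 := fun h => hy ⟨h, h2, h3⟩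
      rw [h2, h3]
      have : 0 < A * (P * y1) ^ 2 := by positivity
      linarith
    · have : 0 < (A * y2) ^ 2 := by positivity
      have : 0 ≤ A * (P * y1 - x3 * y2 - x2 * y3) ^ 2 := by positivity
      rw [h3] at *
      linarith
  · have : 0 < (A * B - K ^ 2) * y3 ^ 2 := by positivity
    positivity

/-- Positivity of `triForm` when at most the first coefficient is negative. -/
theorem triForm_pos_of_nonneg {C1 C2 C3 x1 x2 x3 : ℝ} (h1 : 1 < C1) (h2 : 1 < C2)
    (h3 : 1 < C3) (hA : 0 < gramDet C1 C2 C3)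
    (hx2 : 0 ≤ x2) (hx3 : 0 ≤ x3)
    (hx1 : 0 ≤ x1 ∨ ∀ a b m, a = x2 * (C2 ^ 2 - 1) → b = x3 * (C3 ^ 2 - 1) →
      m = -(x1 * (C1 ^ 2 - 1)) → m ≤ a * C3 + b * C2 ∧
      0 ≤ m ^ 2 + (a ^ 2 + b ^ 2 + 2 * a * b * C1) - 2 * m * (a * C3 + b * C2))
    (hdet : 0 < 2 * x1 * x2 * x3 * (C1 * C2 * C3 - 1) +
      x1 ^ 2 * (C1 ^ 2 - 1) * (x2 * C2 + x3 * C3) + x2 ^ 2 * (C2 ^ 2 - 1) * (x3 * C3 + x1 * C1) +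
      x3 ^ 2 * (C3 ^ 2 - 1) * (x1 * C1 + x2 * C2))
    {y1 y2 y3 : ℝ} (hy : ¬ (y1 = 0 ∧ y2 = 0 ∧ y3 = 0)) :
    0 < triForm C1 C2 C3 x1 x2 x3 y1 y2 y3 := by
  have q1 : 0 < C1 ^ 2 - 1 := by nlinarith
  have q2 : 0 < C2 ^ 2 - 1 := by nlinarith
  have q3 : 0 < C3 ^ 2 - 1 := by nlinarith
  obtain ⟨a, ha⟩ : ∃ a, a = x2 * (C2 ^ 2 - 1) := ⟨_, rfl⟩
  obtain ⟨b, hb⟩ : ∃ b, b = x3 * (C3 ^ 2 - 1) := ⟨_, rfl⟩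
  obtain ⟨m, hm⟩ : ∃ m, m = -(x1 * (C1 ^ 2 - 1)) := ⟨_, rfl⟩
  have ha0 : 0 ≤ a := ha ▸ mul_nonneg hx2 q2.le
  have hb0 : 0 ≤ b := hb ▸ mul_nonneg hx3 q3.le
  have hkey := edge_inequality h1 h2 h3 hA ha0 hb0 (m := m) (by
    rcases hx1 with h | h
    · left
      have := mul_nonneg h q1.le
      linarith
    · exact Or.inr (h a b m ha hb hm))
  have hP := diag_pos_of_det_pos h2 h3 hx2 hx3 hdet
  obtain ⟨P, hPd⟩ : ∃ P, P = x2 * C2 + x3 * C3 := ⟨_, rfl⟩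
  obtain ⟨A, hAd⟩ : ∃ A, A = P * (x1 * C1 + x3 * C3) - x3 ^ 2 := ⟨_, rfl⟩
  obtain ⟨B, hBd⟩ : ∃ B, B = P * (x1 * C1 + x2 * C2) - x2 ^ 2 := ⟨_, rfl⟩
  obtain ⟨K, hKd⟩ : ∃ K, K = -(P * x1) - x2 * x3 := ⟨_, rfl⟩
  have hP' := hP
  rw [← hPd] at hP'
  -- Up to a positive factor, the edge inequality is nonnegativity of the form with matrix `(A, K;
  -- K, B)` at the vector `(a + b C1, a C1 + b)`. As this form has positive determinant,
  -- nonnegativity at one nonzero vector forces `A > 0`.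
  have hQ : 0 ≤ A * (a + b * C1) ^ 2 + 2 * K * (a + b * C1) * (a * C1 + b) +
      B * (a * C1 + b) ^ 2 := by
    refine nonneg_of_mul_nonneg_right (a := (C2 ^ 2 - 1) * (C3 ^ 2 - 1)) ?_ (mul_pos q2 q3)
    refine le_of_le_of_eq (sub_nonneg.2 hkey) ?_
    rw [hAd, hBd, hKd, hPd, ha, hb, hm]
    ring
  have hABK : 0 < A * B - K ^ 2 := by
    have : A * B - K ^ 2 = P * (2 * x1 * x2 * x3 * (C1 * C2 * C3 - 1) +
      x1 ^ 2 * (C1 ^ 2 - 1) * (x2 * C2 + x3 * C3) + x2 ^ 2 * (C2 ^ 2 - 1) * (x3 * C3 + x1 * C1) +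
      x3 ^ 2 * (C3 ^ 2 - 1) * (x1 * C1 + x2 * C2)) := by
      rw [hAd, hBd, hKd, hPd]
      ring
    rw [this]
    exact mul_pos hP' hdet
  have hz : 0 < a * C1 + b := by
    have : 0 < a + b := by
      by_contra! h
      have a0 : a = 0 := by linarith
      have b0 : b = 0 := by linarith
      have f2 : x2 = 0 := by
        rcases mul_eq_zero.1 (ha.symm.trans a0) with h | h <;> [exact h; linarith]
      have f3 : x3 = 0 := by
        rcases mul_eq_zero.1 (hb.symm.trans b0) with h | h <;> [exact h; linarith]
      simp [f2, f3] at hP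
    nlinarith
  have hApos : 0 < A := by
    by_contra! h
    have e : A * (A * (a + b * C1) ^ 2 + 2 * K * (a + b * C1) * (a * C1 + b) +
      B * (a * C1 + b) ^ 2) = (A * (a + b * C1) + K * (a * C1 + b)) ^ 2 +
        (A * B - K ^ 2) * (a * C1 + b) ^ 2 := by ring
    have e1 : 0 < (A * B - K ^ 2) * (a * C1 + b) ^ 2 := by positivity
    have e2 := mul_nonpos_of_nonpos_of_nonneg h hQ
    rw [e] at e2
    exact (add_pos_of_nonneg_of_pos (sq_nonneg _) e1).not_ge e2
  exact triForm_pos_of_minor hP (hPd ▸ hAd ▸ hApos) hdet hy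


/-! ### The power centre and the structure condition -/

/-- Up to a positive factor, the barycentric coordinate of the power centre at the first vertex,
in terms of the hyperbolic cosines of the edges and of the radii. -/
def powerCoord (C1 C2 C3 c1 c2 c3 : ℝ) : ℝ :=
  -(C1 ^ 2 - 1) * c1 + (C1 * C2 - C3) * c2 + (C1 * C3 - C2) * c3

/-- `cᵢ` and `sᵢ` are the hyperbolic cosines and sines of three radii, and `Cᵢ` are the hyperbolic
cosines of the edges for the weights `Iᵢ`, which satisfy the structure condition. -/
structure IsPacking (c1 c2 c3 s1 s2 s3 I1 I2 I3 C1 C2 C3 : ℝ) : Prop where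
  hs1 : 0 < s1
  hs2 : 0 < s2
  hs3 : 0 < s3
  hc1 : 0 < c1
  hc2 : 0 < c2
  hc3 : 0 < c3
  e1 : c1 ^ 2 = s1 ^ 2 + 1
  e2 : c2 ^ 2 = s2 ^ 2 + 1
  e3 : c3 ^ 2 = s3 ^ 2 + 1
  hI1 : -1 < I1
  hI2 : -1 < I2
  hI3 : -1 < I3
  g1 : 0 ≤ I1 + I2 * I3
  g2 : 0 ≤ I2 + I3 * I1
  g3 : 0 ≤ I3 + I1 * I2
  hC1 : C1 = c2 * c3 + I1 * s2 * s3
  hC2 : C2 = c3 * c1 + I2 * s3 * s1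
  hC3 : C3 = c1 * c2 + I3 * s1 * s2

/-- The structure condition makes the last two terms nonnegative, so the sign can only be spoiled by
`1 - I1 ^ 2`. -/
theorem powerCoord_eq_weights {c1 c2 c3 s1 s2 s3 : ℝ} (I1 I2 I3 : ℝ)
    (e2 : c2 ^ 2 = s2 ^ 2 + 1) (e3 : c3 ^ 2 = s3 ^ 2 + 1) :
    powerCoord (c2 * c3 + I1 * s2 * s3) (c3 * c1 + I2 * s3 * s1) (c1 * c2 + I3 * s1 * s2)
      c1 c2 c3 = s2 * s3 * (s2 * s3 * c1 * (1 - I1 ^ 2) + s3 * s1 * c2 * (I3 + I1 * I2) +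
        s1 * s2 * c3 * (I2 + I3 * I1)) := by
  unfold powerCoord
  grind

/-- If `I3 ≤ 1`, the expression equals `(I2 + I1 I3)² + (I1² - 1)(1 - I3²)`, and symmetrically for
`I2`; if all weights exceed `1`, it is clearly positive. -/
theorem weights_det_nonneg {I1 I2 I3 : ℝ} (h1 : 1 < I1) (h2 : -1 < I2) (h3 : -1 < I3) :
    0 ≤ I1 ^ 2 + I2 ^ 2 + I3 ^ 2 + 2 * I1 * I2 * I3 - 1 := by
  by_cases h : I3 ≤ 1
  · have : 0 ≤ (I1 ^ 2 - 1) * (1 - I3 ^ 2) := mul_nonneg (by nlinarith) (by nlinarith)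
    nlinarith [sq_nonneg (I2 + I1 * I3)]
  by_cases h' : I2 ≤ 1
  · have : 0 ≤ (I1 ^ 2 - 1) * (1 - I2 ^ 2) := mul_nonneg (by nlinarith) (by nlinarith)
    nlinarith [sq_nonneg (I3 + I1 * I2)]
  push Not at h h'
  have : 0 < I1 * I2 * I3 := by positivity
  nlinarith [sq_nonneg I2, sq_nonneg I3]

/-- The Gram matrix sends `w` to `gramDet * c`: the combination of the `vᵢ` with coefficients `w`
has products with them proportional to `c`, which characterises the power centre. -/
theorem gram_powerCoord (C1 C2 C3 c1 c2 c3 : ℝ) :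
    powerCoord C1 C2 C3 c1 c2 c3 + C3 * powerCoord C2 C3 C1 c2 c3 c1 +
      C2 * powerCoord C3 C1 C2 c3 c1 c2 = gramDet C1 C2 C3 * c1 := by
  unfold powerCoord gramDet
  ring

theorem gramDet_rotate (x y z : ℝ) : gramDet y z x = gramDet x y z := by
  unfold gramDet
  ring

theorem triForm_rotate (C1 C2 C3 x1 x2 x3 y1 y2 y3 : ℝ) :
    triForm C2 C3 C1 x2 x3 x1 y2 y3 y1 = triForm C1 C2 C3 x1 x2 x3 y1 y2 y3 := by
  unfold triForm
  ring

/-- The determinant of the matrix of derivatives of the `Cᵢ`. -/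
def edgeDet (C1 C2 C3 c1 c2 c3 : ℝ) : ℝ :=
  (c2 * C1 - c3) * (c3 * C2 - c1) * (c1 * C3 - c2) +
    (c3 * C1 - c2) * (c1 * C2 - c3) * (c2 * C3 - c1)

/-- The determinant of `triForm` with coefficients `wᵢ / (Cᵢ² - 1)`, up to a positive factor. -/
def detPoly (C1 C2 C3 w1 w2 w3 : ℝ) : ℝ :=
  2 * w1 * w2 * w3 * (C1 * C2 * C3 - 1) +
    w1 ^ 2 * (w2 * C2 * (C3 ^ 2 - 1) + w3 * C3 * (C2 ^ 2 - 1)) +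
    w2 ^ 2 * (w3 * C3 * (C1 ^ 2 - 1) + w1 * C1 * (C3 ^ 2 - 1)) +
    w3 ^ 2 * (w1 * C1 * (C2 ^ 2 - 1) + w2 * C2 * (C1 ^ 2 - 1))

/-- The leading minor of size two of `triForm` with coefficients `wᵢ / (Cᵢ² - 1)`, up to a positive
factor. -/
def minorPoly (C1 C2 C3 w1 w2 w3 : ℝ) : ℝ :=
  w1 * C1 * (w2 * C2 * (C3 ^ 2 - 1) + w3 * C3 * (C2 ^ 2 - 1)) + w2 * w3 * C2 * C3 * (C1 ^ 2 - 1) +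
    w3 ^ 2 * (C1 ^ 2 - 1) * (C2 ^ 2 - 1)

/-- `edgeDet` is cubic in `c`, so with `gram_powerCoord` this transfers its sign to `detPoly` at the
power centre. -/
theorem edgeDet_gram (C1 C2 C3 w1 w2 w3 : ℝ) :
    edgeDet C1 C2 C3 (w1 + C3 * w2 + C2 * w3) (w2 + C1 * w3 + C3 * w1) (w3 + C2 * w1 + C1 * w2) =
      gramDet C1 C2 C3 * detPoly C1 C2 C3 w1 w2 w3 := by
  unfold edgeDet gramDet detPoly
  ring

namespace IsPacking

variable {c1 c2 c3 s1 s2 s3 I1 I2 I3 C1 C2 C3 : ℝ}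

theorem rotate (h : IsPacking c1 c2 c3 s1 s2 s3 I1 I2 I3 C1 C2 C3) :
    IsPacking c2 c3 c1 s2 s3 s1 I2 I3 I1 C2 C3 C1 :=
  ⟨h.hs2, h.hs3, h.hs1, h.hc2, h.hc3, h.hc1, h.e2, h.e3, h.e1, h.hI2, h.hI3, h.hI1, h.g2, h.g3,
    h.g1, h.hC2, h.hC3, h.hC1⟩

theorem one_lt (h : IsPacking c1 c2 c3 s1 s2 s3 I1 I2 I3 C1 C2 C3) : 1 < C1 := by
  obtain ⟨hs1, hs2, hs3, hc1, hc2, hc3, e1, e2, e3, h1, h2, h3, g1, g2, g3, rfl, -, -⟩ := h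
  have h4 : 0 < (1 + I1) * (s2 * s3) := mul_pos (by linarith) (by positivity)
  have h5 : 1 + s2 * s3 ≤ c2 * c3 := by
    have : (1 + s2 * s3) ^ 2 ≤ (c2 * c3) ^ 2 := by
      rw [mul_pow, e2, e3]
      nlinarith [sq_nonneg (s2 - s3)]
    exact (abs_le.1 (abs_le_of_sq_le_sq this (by positivity))).2
  linarith

theorem weights_of_powerCoord_nonpos (h : IsPacking c1 c2 c3 s1 s2 s3 I1 I2 I3 C1 C2 C3)
    (hW : powerCoord C1 C2 C3 c1 c2 c3 ≤ 0) :
    s1 * c2 * (I3 + I1 * I2) ≤ s2 * c1 * (I1 ^ 2 - 1) ∧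
      s1 * c3 * (I2 + I3 * I1) ≤ s3 * c1 * (I1 ^ 2 - 1) := by
  obtain ⟨hs1, hs2, hs3, hc1, hc2, hc3, e1, e2, e3, h1, h2, h3, g1, g2, g3, rfl, rfl, rfl⟩ := h
  rw [powerCoord_eq_weights I1 I2 I3 e2 e3] at hW
  have h := nonpos_of_mul_nonpos_right hW (mul_pos hs2 hs3)
  have p2 : 0 ≤ s1 * s2 * c3 * (I2 + I3 * I1) := by positivity
  have p3 : 0 ≤ s3 * s1 * c2 * (I3 + I1 * I2) := by positivity
  constructor
  · refine le_of_mul_le_mul_left (a := s3) ?_ hs3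
    linarith
  · refine le_of_mul_le_mul_left (a := s2) ?_ hs2
    linarith

theorem one_lt_weight (h : IsPacking c1 c2 c3 s1 s2 s3 I1 I2 I3 C1 C2 C3)
    (hW : powerCoord C1 C2 C3 c1 c2 c3 < 0) : 1 < I1 := by
  obtain ⟨hs1, hs2, hs3, hc1, hc2, hc3, e1, e2, e3, h1, h2, h3, g1, g2, g3, rfl, rfl, rfl⟩ := h
  rw [powerCoord_eq_weights I1 I2 I3 e2 e3] at hW
  by_contra! hI
  refine hW.not_ge (mul_nonneg (by positivity) ?_)
  have : 0 ≤ s2 * s3 * c1 * (1 - I1 ^ 2) := mul_nonneg (by positivity) (by nlinarith)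
  positivity

/-- At most one of the barycentric coordinates of the power centre is negative. -/
theorem powerCoord_nonneg (h : IsPacking c1 c2 c3 s1 s2 s3 I1 I2 I3 C1 C2 C3) (hI : 1 < I1)
    (hW : powerCoord C1 C2 C3 c1 c2 c3 ≤ 0) :
    0 ≤ powerCoord C2 C3 C1 c2 c3 c1 ∧ 0 ≤ powerCoord C3 C1 C2 c3 c1 c2 := by
  obtain ⟨hl3, hl2⟩ := h.weights_of_powerCoord_nonpos hW
  have hD := weights_det_nonneg hI h.hI2 h.hI3
  have hs1 := h.hs1
  have hs2 := h.hs2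
  have hs3 := h.hs3
  have hc1 := h.hc1
  have hc2 := h.hc2
  have hc3 := h.hc3
  have g2 := h.g2
  have g3 := h.g3
  have hI' : 0 < I1 ^ 2 - 1 := by nlinarith
  constructor
  -- Two negative coordinates bound `I3 + I1 I2` from above twice. The product of the bounds, `(I3 +
  -- I1 I2)² < (I1² - 1)(I2² - 1)`, contradicts `weights_det_nonneg`.
  · by_contra! hW2
    have hI2 := h.rotate.one_lt_weight hW2
    obtain ⟨-, hl⟩ := h.rotate.weights_of_powerCoord_nonpos hW2.le
    have hstrict : s2 * c1 * (I3 + I1 * I2) < s1 * c2 * (I2 ^ 2 - 1) := by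
      have hW' := hW2
      rw [h.hC1, h.hC2, h.hC3, powerCoord_eq_weights I2 I3 I1 h.e3 h.e1] at hW'
      have h0 := neg_of_mul_neg_right hW' (mul_nonneg hs3.le hs1.le)
      have p : 0 ≤ s1 * s2 * c3 * (I1 + I2 * I3) :=
        mul_nonneg (by positivity) h.g1
      refine lt_of_mul_lt_mul_left (a := s3) ?_ hs3.le
      linarith
    have hmul : (s1 * c2 * (I3 + I1 * I2)) * (s2 * c1 * (I3 + I1 * I2)) <
        (s2 * c1 * (I1 ^ 2 - 1)) * (s1 * c2 * (I2 ^ 2 - 1)) :=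
      mul_lt_mul' hl3 hstrict (by positivity) (by positivity)
    have : (I3 + I1 * I2) ^ 2 < (I1 ^ 2 - 1) * (I2 ^ 2 - 1) := by
      refine lt_of_mul_lt_mul_left (a := s1 * s2 * c1 * c2) ?_ (by positivity)
      linarith
    linarith
  · by_contra! hW3
    have hI3 := h.rotate.rotate.one_lt_weight hW3
    have hstrict : s3 * c1 * (I2 + I3 * I1) < s1 * c3 * (I3 ^ 2 - 1) := by
      have hW' := hW3
      rw [h.hC1, h.hC2, h.hC3, powerCoord_eq_weights I3 I1 I2 h.e1 h.e2] at hW'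
      have h0 := neg_of_mul_neg_right hW' (mul_nonneg hs1.le hs2.le)
      have p : 0 ≤ s3 * s1 * c2 * (I1 + I2 * I3) :=
        mul_nonneg (by positivity) h.g1
      refine lt_of_mul_lt_mul_left (a := s2) ?_ hs2.le
      linarith
    have hmul : (s1 * c3 * (I2 + I3 * I1)) * (s3 * c1 * (I2 + I3 * I1)) <
        (s3 * c1 * (I1 ^ 2 - 1)) * (s1 * c3 * (I3 ^ 2 - 1)) :=
      mul_lt_mul' hl2 hstrict (by positivity) (by positivity)
    have : (I2 + I3 * I1) ^ 2 < (I1 ^ 2 - 1) * (I3 ^ 2 - 1) := by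
      refine lt_of_mul_lt_mul_left (a := s1 * s3 * c1 * c3) ?_ (by positivity)
      linarith
    linarith

/-- Separates `∑ cᵢ wᵢ`, which is nonnegative exactly when the power centre is timelike or lightlike
if `gramDet > 0`, from a term depending on the `sᵢ` and the weights. -/
theorem gramDet_eq (h : IsPacking c1 c2 c3 s1 s2 s3 I1 I2 I3 C1 C2 C3) :
    gramDet C1 C2 C3 = c1 * powerCoord C1 C2 C3 c1 c2 c3 + c2 * powerCoord C2 C3 C1 c2 c3 c1 +
      c3 * powerCoord C3 C1 C2 c3 c1 c2 + s1 ^ 2 * s2 ^ 2 * s3 ^ 2 *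
        (I1 ^ 2 + I2 ^ 2 + I3 ^ 2 + 2 * I1 * I2 * I3 - 1) := by
  obtain ⟨-, -, -, -, -, -, e1, e2, e3, -, -, -, -, -, -, rfl, rfl, rfl⟩ := h
  unfold powerCoord gramDet
  grind

theorem edgeDet_pos (h : IsPacking c1 c2 c3 s1 s2 s3 I1 I2 I3 C1 C2 C3) :
    0 < edgeDet C1 C2 C3 c1 c2 c3 := by
  obtain ⟨hs1, hs2, hs3, hc1, hc2, hc3, e1, e2, e3, h1, h2, h3, g1, g2, g3, rfl, rfl, rfl⟩ := h
  have r : ∀ {c c' s s' : ℝ} (I : ℝ), c ^ 2 = s ^ 2 + 1 →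
      c * (c * c' + I * s * s') - c' = s * (s * c' + I * c * s') := by
    intro c c' s s' I h
    linear_combination c' * h
  have r' : ∀ {c c' s s' : ℝ} (I : ℝ), c ^ 2 = s ^ 2 + 1 →
      c * (c' * c + I * s' * s) - c' = s * (s * c' + I * c * s') := by
    intro c c' s s' I h
    linear_combination c' * h
  rw [edgeDet, r _ e2, r _ e3, r _ e1, r' _ e3, r' _ e1, r' _ e2]
  -- Grouping by weights leaves the three structure expressions times squares, plus a strictly
  -- positive multiple of `(1 + I1)(1 + I2)(1 + I3)`.
  have key : s2 * (s2 * c3 + I1 * c2 * s3) * (s3 * (s3 * c1 + I2 * c3 * s1)) *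
      (s1 * (s1 * c2 + I3 * c1 * s2)) + s3 * (s3 * c2 + I1 * c3 * s2) *
      (s1 * (s1 * c3 + I2 * c1 * s3)) * (s2 * (s2 * c1 + I3 * c2 * s1)) =
      s1 * s2 * s3 * ((I3 + I1 * I2) * s3 * c3 * (s1 * c2 - s2 * c1) ^ 2 +
        (I2 + I3 * I1) * s2 * c2 * (s3 * c1 - s1 * c3) ^ 2 +
        (I1 + I2 * I3) * s1 * c1 * (s2 * c3 - s3 * c2) ^ 2 +
        2 * s1 * s2 * s3 * c1 * c2 * c3 * ((1 + I1) * (1 + I2) * (1 + I3))) := by ring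
  rw [key]
  have p1 : 0 < 1 + I1 := by linarith
  have p2 : 0 < 1 + I2 := by linarith
  have p3 : 0 < 1 + I3 := by linarith
  positivity

theorem detPoly_pos (h : IsPacking c1 c2 c3 s1 s2 s3 I1 I2 I3 C1 C2 C3)
    (hA : 0 < gramDet C1 C2 C3) : 0 < detPoly C1 C2 C3 (powerCoord C1 C2 C3 c1 c2 c3)
      (powerCoord C2 C3 C1 c2 c3 c1) (powerCoord C3 C1 C2 c3 c1 c2) := by
  have hG1 := gram_powerCoord C1 C2 C3 c1 c2 c3
  have hG2 := gram_powerCoord C2 C3 C1 c2 c3 c1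
  have hG3 := gram_powerCoord C3 C1 C2 c3 c1 c2
  rw [gramDet_rotate] at hG2
  rw [← gramDet_rotate] at hG3
  have hf := edgeDet_gram C1 C2 C3 (powerCoord C1 C2 C3 c1 c2 c3)
    (powerCoord C2 C3 C1 c2 c3 c1) (powerCoord C3 C1 C2 c3 c1 c2)
  rw [hG1, hG2, hG3] at hf
  have hf' : 0 < edgeDet C1 C2 C3 (gramDet C1 C2 C3 * c1) (gramDet C1 C2 C3 * c2)
      (gramDet C1 C2 C3 * c3) := by
    have e : edgeDet C1 C2 C3 (gramDet C1 C2 C3 * c1) (gramDet C1 C2 C3 * c2)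
      (gramDet C1 C2 C3 * c3) = gramDet C1 C2 C3 ^ 3 * edgeDet C1 C2 C3 c1 c2 c3 := by
      unfold edgeDet
      ring
    rw [e]
    exact mul_pos (by positivity) h.edgeDet_pos
  rw [hf] at hf'
  exact pos_of_mul_pos_right hf' hA.le

end IsPacking

/-! ### Minors of the form with cleared denominators -/

section Coefficients

variable {C1 C2 C3 w1 w2 w3 : ℝ}

theorem minorPoly_eq_div (h1 : 1 < C1) (h2 : 1 < C2) (h3 : 1 < C3) :
    minorPoly C1 C2 C3 w1 w2 w3 = (C1 ^ 2 - 1) * (C2 ^ 2 - 1) * (C3 ^ 2 - 1) *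
      ((w2 / (C2 ^ 2 - 1) * C2 + w3 / (C3 ^ 2 - 1) * C3) *
        (w1 / (C1 ^ 2 - 1) * C1 + w3 / (C3 ^ 2 - 1) * C3) - (w3 / (C3 ^ 2 - 1)) ^ 2) := by
  have q1 : C1 ^ 2 - 1 ≠ 0 := by nlinarith
  have q2 : C2 ^ 2 - 1 ≠ 0 := by nlinarith
  have q3 : C3 ^ 2 - 1 ≠ 0 := by nlinarith
  unfold minorPoly
  field_simp
  ring

theorem detPoly_eq_div (h1 : 1 < C1) (h2 : 1 < C2) (h3 : 1 < C3) :
    detPoly C1 C2 C3 w1 w2 w3 = (C1 ^ 2 - 1) * (C2 ^ 2 - 1) * (C3 ^ 2 - 1) *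
      (2 * (w1 / (C1 ^ 2 - 1)) * (w2 / (C2 ^ 2 - 1)) * (w3 / (C3 ^ 2 - 1)) * (C1 * C2 * C3 - 1) +
      (w1 / (C1 ^ 2 - 1)) ^ 2 * (C1 ^ 2 - 1) *
        (w2 / (C2 ^ 2 - 1) * C2 + w3 / (C3 ^ 2 - 1) * C3) +
      (w2 / (C2 ^ 2 - 1)) ^ 2 * (C2 ^ 2 - 1) *
        (w3 / (C3 ^ 2 - 1) * C3 + w1 / (C1 ^ 2 - 1) * C1) +
      (w3 / (C3 ^ 2 - 1)) ^ 2 * (C3 ^ 2 - 1) *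
        (w1 / (C1 ^ 2 - 1) * C1 + w2 / (C2 ^ 2 - 1) * C2)) := by
  have q1 : C1 ^ 2 - 1 ≠ 0 := by nlinarith
  have q2 : C2 ^ 2 - 1 ≠ 0 := by nlinarith
  have q3 : C3 ^ 2 - 1 ≠ 0 := by nlinarith
  unfold detPoly
  field_simp

/-- The product of the two principal minors of size two that contain the first diagonal entry is a
square plus a positive multiple of that entry times the determinant, hence positive. -/
theorem minorPoly_ne_zero (h1 : 1 < C1) (h2 : 1 < C2) (h3 : 1 < C3) (hw2 : 0 ≤ w2) (hw3 : 0 ≤ w3)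
    (hdet : 0 < detPoly C1 C2 C3 w1 w2 w3) : minorPoly C1 C2 C3 w1 w2 w3 ≠ 0 := by
  have q1 : 0 < C1 ^ 2 - 1 := by nlinarith
  have q2 : 0 < C2 ^ 2 - 1 := by nlinarith
  have q3 : 0 < C3 ^ 2 - 1 := by nlinarith
  intro h
  have e : (C1 ^ 2 - 1) * ((w2 * C2 * (C3 ^ 2 - 1) + w3 * C3 * (C2 ^ 2 - 1)) *
      detPoly C1 C2 C3 w1 w2 w3) =
      minorPoly C1 C2 C3 w1 w2 w3 * minorPoly C1 C3 C2 w1 w3 w2 -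
        (w1 * (w2 * C2 * (C3 ^ 2 - 1) + w3 * C3 * (C2 ^ 2 - 1)) + w2 * w3 * (C1 ^ 2 - 1)) ^ 2 := by
    unfold detPoly minorPoly
    ring
  rw [h] at e
  have hP : 0 < w2 * C2 * (C3 ^ 2 - 1) + w3 * C3 * (C2 ^ 2 - 1) := by
    rw [detPoly_eq_div h1 h2 h3] at hdet
    have hd := diag_pos_of_det_pos h2 h3 (div_nonneg hw2 q2.le) (div_nonneg hw3 q3.le)
      (pos_of_mul_pos_right hdet (by positivity))
    have : w2 * C2 * (C3 ^ 2 - 1) + w3 * C3 * (C2 ^ 2 - 1) = (C2 ^ 2 - 1) * (C3 ^ 2 - 1) *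
        (w2 / (C2 ^ 2 - 1) * C2 + w3 / (C3 ^ 2 - 1) * C3) := by
      field_simp
    rw [this]
    positivity
  have := mul_pos q1 (mul_pos hP hdet)
  linarith [sq_nonneg
    (w1 * (w2 * C2 * (C3 ^ 2 - 1) + w3 * C3 * (C2 ^ 2 - 1)) + w2 * w3 * (C1 ^ 2 - 1))]

theorem triForm_pos_of_minorPoly (h1 : 1 < C1) (h2 : 1 < C2) (h3 : 1 < C3) (hw2 : 0 ≤ w2)
    (hw3 : 0 ≤ w3) (hdet : 0 < detPoly C1 C2 C3 w1 w2 w3) (hM : 0 < minorPoly C1 C2 C3 w1 w2 w3)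
    {y1 y2 y3 : ℝ} (hy : ¬ (y1 = 0 ∧ y2 = 0 ∧ y3 = 0)) :
    0 < triForm C1 C2 C3 (w1 / (C1 ^ 2 - 1)) (w2 / (C2 ^ 2 - 1)) (w3 / (C3 ^ 2 - 1)) y1 y2 y3 := by
  have q1 : 0 < C1 ^ 2 - 1 := by nlinarith
  have q2 : 0 < C2 ^ 2 - 1 := by nlinarith
  have q3 : 0 < C3 ^ 2 - 1 := by nlinarith
  rw [detPoly_eq_div h1 h2 h3] at hdet
  rw [minorPoly_eq_div h1 h2 h3] at hM
  have hd := pos_of_mul_pos_right hdet (by positivity)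
  exact triForm_pos_of_minor
    (diag_pos_of_det_pos h2 h3 (div_nonneg hw2 q2.le) (div_nonneg hw3 q3.le) hd)
    (pos_of_mul_pos_right hM (by positivity)) hd hy

/-- `hw` and `ht` are the cone conditions of `edge_inequality` for `a = w2`, `b = w3`, `m = -w1`. -/
theorem minorPoly_pos_of_timelike (h1 : 1 < C1) (h2 : 1 < C2) (h3 : 1 < C3)
    (hA : 0 < gramDet C1 C2 C3) (hw2 : 0 ≤ w2) (hw3 : 0 ≤ w3)
    (hdet : 0 < detPoly C1 C2 C3 w1 w2 w3) (hw : 0 ≤ w1 + C3 * w2 + C2 * w3)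
    (ht : 0 ≤ w1 ^ 2 + w2 ^ 2 + w3 ^ 2 + 2 * w2 * w3 * C1 + 2 * w3 * w1 * C2 + 2 * w1 * w2 * C3) :
    0 < minorPoly C1 C2 C3 w1 w2 w3 := by
  have q1 : 0 < C1 ^ 2 - 1 := by nlinarith
  have q2 : 0 < C2 ^ 2 - 1 := by nlinarith
  have q3 : 0 < C3 ^ 2 - 1 := by nlinarith
  rw [detPoly_eq_div h1 h2 h3] at hdet
  have hd := pos_of_mul_pos_right hdet (by positivity)
  have hP := diag_pos_of_det_pos h2 h3 (div_nonneg hw2 q2.le) (div_nonneg hw3 q3.le) hd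
  have hpos := triForm_pos_of_nonneg h1 h2 h3 hA (div_nonneg hw2 q2.le) (div_nonneg hw3 q3.le)
    (Or.inr (by
      intro a b m ha hb hm
      rw [div_mul_cancel₀ _ q2.ne'] at ha
      rw [div_mul_cancel₀ _ q3.ne'] at hb
      rw [div_mul_cancel₀ _ q1.ne'] at hm
      subst ha hb hm
      constructor <;> linarith)) hd
    -- With `P` the first diagonal entry, the form at `(x3, P, 0)` is `P` times the leading minor of
    -- size two.
    (y1 := w3 / (C3 ^ 2 - 1)) (y2 := w2 / (C2 ^ 2 - 1) * C2 + w3 / (C3 ^ 2 - 1) * C3) (y3 := 0)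
    (fun h => hP.ne' h.2.1)
  rw [minorPoly_eq_div h1 h2 h3]
  refine mul_pos (by positivity) (pos_of_mul_pos_right (lt_of_lt_of_eq hpos ?_) hP.le)
  unfold triForm
  ring

end Coefficients

/-! ### Sign of the leading minor for packings, and positivity of the form -/

namespace IsPacking

variable {c1 c2 c3 s1 s2 s3 I1 I2 I3 C1 C2 C3 : ℝ}

theorem minorPoly_pos_of_sum_nonneg (h : IsPacking c1 c2 c3 s1 s2 s3 I1 I2 I3 C1 C2 C3)
    (hA : 0 < gramDet C1 C2 C3) (hw2 : 0 ≤ powerCoord C2 C3 C1 c2 c3 c1)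
    (hw3 : 0 ≤ powerCoord C3 C1 C2 c3 c1 c2)
    (hsum : 0 ≤ c1 * powerCoord C1 C2 C3 c1 c2 c3 + c2 * powerCoord C2 C3 C1 c2 c3 c1 +
      c3 * powerCoord C3 C1 C2 c3 c1 c2) :
    0 < minorPoly C1 C2 C3 (powerCoord C1 C2 C3 c1 c2 c3) (powerCoord C2 C3 C1 c2 c3 c1)
      (powerCoord C3 C1 C2 c3 c1 c2) := by
  have hG1 := gram_powerCoord C1 C2 C3 c1 c2 c3
  have hG2 := gram_powerCoord C2 C3 C1 c2 c3 c1
  have hG3 := gram_powerCoord C3 C1 C2 c3 c1 c2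
  rw [gramDet_rotate] at hG2
  rw [← gramDet_rotate] at hG3
  refine minorPoly_pos_of_timelike h.one_lt h.rotate.one_lt h.rotate.rotate.one_lt hA hw2 hw3
    (h.detPoly_pos hA) ?_ ?_
  · rw [hG1]
    exact (mul_pos hA h.hc1).le
  · have := mul_nonneg hA.le hsum
    refine le_of_le_of_eq this ?_
    linear_combination (-powerCoord C1 C2 C3 c1 c2 c3) * hG1 -
      powerCoord C2 C3 C1 c2 c3 c1 * hG2 - powerCoord C3 C1 C2 c3 c1 c2 * hG3

end IsPacking

namespace IsPacking

variable {c1 c2 c3 s1 s2 s3 I1 I2 I3 C1 C2 C3 : ℝ}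

set_option maxHeartbeats 1600000 in
/-- Along the rays of `(coth r₂, coth r₃)`, with `r₁` fixed, the leading minor does not vanish. -/
theorem minorPoly_pos_of_neg (h : IsPacking c1 c2 c3 s1 s2 s3 I1 I2 I3 C1 C2 C3)
    (hA : 0 < gramDet C1 C2 C3) (hw : powerCoord C1 C2 C3 c1 c2 c3 < 0) :
    0 < minorPoly C1 C2 C3 (powerCoord C1 C2 C3 c1 c2 c3) (powerCoord C2 C3 C1 c2 c3 c1)
      (powerCoord C3 C1 C2 c3 c1 c2) := by
  have hI := h.one_lt_weight hw
  have hD := weights_det_nonneg hI h.hI2 h.hI3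
  obtain ⟨hs1, hs2, hs3, hc1, hc2, hc3, e1, e2, e3, h1, h2, h3, g1, g2, g3, hC1, hC2, hC3⟩ := id h
  -- `coth r₂` and `coth r₃` are multiplied by `t`; `v t` and `w t` restore `cosh² - sinh² = 1`, and
  -- `t = 1` is the given packing.
  set v : ℝ → ℝ := fun t => √(t ^ 2 * c2 ^ 2 - s2 ^ 2) with hv
  set w : ℝ → ℝ := fun t => √(t ^ 2 * c3 ^ 2 - s3 ^ 2) with hw'
  have hvpos : ∀ t, 1 ≤ t → 0 < t ^ 2 * c2 ^ 2 - s2 ^ 2 := by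
    intro t ht
    have : 0 ≤ (t ^ 2 - 1) * c2 ^ 2 := mul_nonneg (by nlinarith) (sq_nonneg _)
    linarith
  have hwpos : ∀ t, 1 ≤ t → 0 < t ^ 2 * c3 ^ 2 - s3 ^ 2 := by
    intro t ht
    have : 0 ≤ (t ^ 2 - 1) * c3 ^ 2 := mul_nonneg (by nlinarith) (sq_nonneg _)
    linarith
  have hv0 : ∀ t, 1 ≤ t → 0 < v t := fun t ht => Real.sqrt_pos.2 (hvpos t ht)
  have hw0 : ∀ t, 1 ≤ t → 0 < w t := fun t ht => Real.sqrt_pos.2 (hwpos t ht)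
  have hv2 : ∀ t, 1 ≤ t → v t ^ 2 = t ^ 2 * c2 ^ 2 - s2 ^ 2 :=
    fun t ht => Real.sq_sqrt (hvpos t ht).le
  have hw2 : ∀ t, 1 ≤ t → w t ^ 2 = t ^ 2 * c3 ^ 2 - s3 ^ 2 :=
    fun t ht => Real.sq_sqrt (hwpos t ht).le
  have hv1 : v 1 = 1 := by
    rw [hv]
    simp [e2]
  have hw1 : w 1 = 1 := by
    rw [hw']
    simp [e3]
  set p2 : ℝ → ℝ := fun t => t * c2 / v t with hp2
  set p3 : ℝ → ℝ := fun t => t * c3 / w t with hp3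
  set q2 : ℝ → ℝ := fun t => s2 / v t with hq2
  set q3 : ℝ → ℝ := fun t => s3 / w t with hq3
  set D1 : ℝ → ℝ := fun t => p2 t * p3 t + I1 * q2 t * q3 t with hD1
  set D2 : ℝ → ℝ := fun t => p3 t * c1 + I2 * q3 t * s1 with hD2
  set D3 : ℝ → ℝ := fun t => c1 * p2 t + I3 * s1 * q2 t with hD3
  have hpack : ∀ t, 1 ≤ t →
      IsPacking c1 (p2 t) (p3 t) s1 (q2 t) (q3 t) I1 I2 I3 (D1 t) (D2 t) (D3 t) := by
    intro t ht
    have a1 := hv0 t ht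
    have a2 := hw0 t ht
    have t0 : 0 < t := by linarith
    refine ⟨hs1, div_pos hs2 a1, div_pos hs3 a2, hc1, div_pos (by positivity) a1,
      div_pos (by positivity) a2, e1, ?_, ?_, h1, h2, h3, g1, g2, g3, rfl, rfl, rfl⟩
    · simp only [hp2, hq2]
      have := hv2 t ht
      field_simp
      linarith
    · simp only [hp3, hq3]
      have := hw2 t ht
      field_simp
      linarith
  have hp21 : p2 1 = c2 := by simp [hp2, hv1]
  have hp31 : p3 1 = c3 := by simp [hp3, hw1]
  have hD11 : D1 1 = C1 := by simp [hD1, hp2, hp3, hq2, hq3, hv1, hw1, hC1]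
  have hD21 : D2 1 = C2 := by simp [hD2, hp3, hq3, hw1, hC2]
  have hD31 : D3 1 = C3 := by simp [hD3, hp2, hq2, hv1, hC3]
  -- the coefficients of the quadratic polynomial in `t`
  obtain ⟨E0, hE0⟩ : ∃ E, E = s2 ^ 2 * s3 ^ 2 * c1 ^ 2 * (1 - I1 ^ 2) := ⟨_, rfl⟩
  obtain ⟨E1, hE1⟩ : ∃ E, E = s1 * s2 * s3 * c1 *
    (s3 * c2 * (I3 + I1 * I2) + s2 * c3 * (I2 + I3 * I1)) := ⟨_, rfl⟩
  obtain ⟨E2, hE2⟩ : ∃ E, E = s3 ^ 2 * s1 ^ 2 * c2 ^ 2 * (1 - I2 ^ 2) +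
    s1 ^ 2 * s2 ^ 2 * c3 ^ 2 * (1 - I3 ^ 2) +
    2 * s1 ^ 2 * s2 * s3 * c2 * c3 * (I1 + I2 * I3) := ⟨_, rfl⟩
  obtain ⟨K, hK⟩ : ∃ K, K = s1 ^ 2 * s2 ^ 2 * s3 ^ 2 *
    (I1 ^ 2 + I2 ^ 2 + I3 ^ 2 + 2 * I1 * I2 * I3 - 1) := ⟨_, rfl⟩
  have hfirst : ∀ t, 1 ≤ t → v t ^ 2 * w t ^ 2 *
      (c1 * powerCoord (D1 t) (D2 t) (D3 t) c1 (p2 t) (p3 t)) = E0 + t * E1 := by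
    intro t ht
    have a1 := hv0 t ht
    have a2 := hw0 t ht
    simp only [hD1, hD2, hD3]
    rw [powerCoord_eq_weights I1 I2 I3 (hpack t ht).e2 (hpack t ht).e3]
    simp only [hp2, hp3, hq2, hq3, hE0, hE1]
    field_simp
    ring
  have hrest : ∀ t, 1 ≤ t → v t ^ 2 * w t ^ 2 *
      (p2 t * powerCoord (D2 t) (D3 t) (D1 t) (p2 t) (p3 t) c1 +
        p3 t * powerCoord (D3 t) (D1 t) (D2 t) (p3 t) c1 (p2 t)) = t * (E1 + t * E2) := by
    intro t ht
    have a1 := hv0 t ht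
    have a2 := hw0 t ht
    simp only [hD1, hD2, hD3]
    rw [powerCoord_eq_weights I2 I3 I1 (hpack t ht).e3 e1,
      powerCoord_eq_weights I3 I1 I2 e1 (hpack t ht).e2]
    simp only [hp2, hp3, hq2, hq3, hE1, hE2]
    field_simp
    ring
  have hgram : ∀ t, 1 ≤ t → v t ^ 2 * w t ^ 2 * gramDet (D1 t) (D2 t) (D3 t) =
      E0 + 2 * t * E1 + t ^ 2 * E2 + K := by
    intro t ht
    have a1 := hv0 t ht
    have a2 := hw0 t ht
    have f1 := hfirst t ht
    have f2 := hrest t ht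
    have f3 : v t ^ 2 * w t ^ 2 * (s1 ^ 2 * q2 t ^ 2 * q3 t ^ 2 *
        (I1 ^ 2 + I2 ^ 2 + I3 ^ 2 + 2 * I1 * I2 * I3 - 1)) = K := by
      simp only [hq2, hq3, hK]
      field_simp
    rw [(hpack t ht).gramDet_eq]
    linear_combination f1 + f2 + f3
  have hneg : ∀ t, 1 ≤ t → E0 + t * E1 ≤ 0 →
      powerCoord (D1 t) (D2 t) (D3 t) c1 (p2 t) (p3 t) ≤ 0 := by
    intro t ht hle
    rw [← hfirst t ht, ← mul_assoc] at hle
    have := hv0 t ht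
    have := hw0 t ht
    exact nonpos_of_mul_nonpos_right hle (by positivity)
  have hothers : ∀ t, 1 ≤ t → E0 + t * E1 ≤ 0 → 0 ≤ E1 + t * E2 := by
    intro t ht hle
    obtain ⟨b2, b3⟩ := (hpack t ht).powerCoord_nonneg hI (hneg t ht hle)
    have := hv0 t ht
    have := hw0 t ht
    have d2 := (hpack t ht).hc2
    have d3 := (hpack t ht).hc3
    refine nonneg_of_mul_nonneg_right (a := t) ?_ (by linarith)
    rw [← hrest t ht]
    positivity
  have hE0neg : E0 < 0 := by
    have : 0 < s2 ^ 2 * s3 ^ 2 * c1 ^ 2 * (I1 ^ 2 - 1) :=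
      mul_pos (by positivity) (by nlinarith)
    rw [hE0]
    linarith
  have hE1nn : 0 ≤ E1 := by
    rw [hE1]
    positivity
  have hstart : E0 + E1 < 0 := by
    have := hfirst 1 le_rfl
    rw [hD11, hD21, hD31, hp21, hp31, hv1, hw1] at this
    have := mul_neg_of_pos_of_neg hc1 hw
    linarith
  have hG1 : 0 < E0 + 2 * E1 + E2 + K := by
    have := hgram 1 le_rfl
    rw [hD11, hD21, hD31, hv1, hw1] at this
    linarith
  -- The difference of `v² w² * gramDet` between `t` and `1` is `(t - 1)(2 E1 + (t + 1) E2)`,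
  -- nonnegative because `E1 + t E2 ≥ 0`.
  have hgpos : ∀ t, 1 ≤ t → E0 + t * E1 ≤ 0 → 0 < gramDet (D1 t) (D2 t) (D3 t) := by
    intro t ht hle
    have a := hothers t ht hle
    have := hv0 t ht
    have := hw0 t ht
    refine pos_of_mul_pos_right (a := v t ^ 2 * w t ^ 2) ?_ (by positivity)
    rw [hgram t ht]
    have b : 0 ≤ (t - 1) * (2 * E1 + (t + 1) * E2) := by
      refine mul_nonneg (by linarith) ?_
      rcases le_or_gt 0 E2 with h0 | h0
      · have := mul_nonneg (by linarith : 0 ≤ t + 1) h0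
        linarith
      · nlinarith
    linarith
  -- `T` is a parameter at which `∑ cᵢ wᵢ ≥ 0` while still `w₁ ≤ 0`: either `1`, or the zero `-E0 /
  -- E1` of `w₁`. If `E1 = 0`, `w₁` never reaches zero, but `K > 0` forces `E2 > 0` and the term `T²
  -- E2` wins.
  obtain ⟨T, hT1, hT2, hT3⟩ : ∃ T, 1 ≤ T ∧ E0 + T * E1 ≤ 0 ∧ 0 ≤ E0 + 2 * T * E1 + T ^ 2 * E2 := by
    by_cases hs : 0 ≤ E0 + 2 * E1 + E2
    · exact ⟨1, le_rfl, by linarith, by linarith⟩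
    rcases hE1nn.eq_or_lt with h0 | h0
    · have hKpos : 0 < K := by linarith
      have hid : E1 ^ 2 - E0 * E2 =
          c1 ^ 2 * (s3 ^ 2 * c2 ^ 2 + s2 ^ 2 * c3 ^ 2 + 2 * I1 * s2 * s3 * c2 * c3) * K := by
        rw [hE0, hE1, hE2, hK]
        ring
      have hE2pos : 0 < E2 := by
        have : 0 < (-E0) * E2 := by
          rw [← h0] at hid
          have : 0 < c1 ^ 2 * (s3 ^ 2 * c2 ^ 2 + s2 ^ 2 * c3 ^ 2 +
            2 * I1 * s2 * s3 * c2 * c3) * K := by positivity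
          linarith
        exact pos_of_mul_pos_right this (by linarith)
      have hq : 0 < -E0 / E2 := div_pos (by linarith) hE2pos
      refine ⟨1 + -E0 / E2, by linarith, by rw [← h0]; linarith, ?_⟩
      have e : (1 + -E0 / E2) * E2 = E2 - E0 := by field_simp; ring
      have : (1 + -E0 / E2) ^ 2 * E2 = (E2 - E0) + (-E0 / E2) * (E2 - E0) := by
        rw [sq, mul_assoc, e]
        ring
      rw [this, ← h0]
      have := mul_pos hq (by linarith : 0 < E2 - E0)
      linarith
    · have hT : E0 + (-E0 / E1) * E1 = 0 := by field_simp; ring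
      have hT1 : 1 ≤ -E0 / E1 := by
        rw [le_div_iff₀ h0]
        linarith
      refine ⟨-E0 / E1, hT1, hT.le, ?_⟩
      have := mul_nonneg (by linarith : 0 ≤ -E0 / E1) (hothers _ hT1 hT.le)
      linarith
  have hle : ∀ t ∈ Set.Icc 1 T, E0 + t * E1 ≤ 0 := by
    intro t ht
    have := mul_le_mul_of_nonneg_right ht.2 hE1nn
    linarith
  set M : ℝ → ℝ := fun t => minorPoly (D1 t) (D2 t) (D3 t)
    (powerCoord (D1 t) (D2 t) (D3 t) c1 (p2 t) (p3 t))
    (powerCoord (D2 t) (D3 t) (D1 t) (p2 t) (p3 t) c1)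
    (powerCoord (D3 t) (D1 t) (D2 t) (p3 t) c1 (p2 t)) with hM
  have hMne : ∀ t ∈ Set.Icc 1 T, M t ≠ 0 := by
    intro t ht
    have hp := hpack t ht.1
    obtain ⟨b2, b3⟩ := hp.powerCoord_nonneg hI (hneg t ht.1 (hle t ht))
    exact minorPoly_ne_zero hp.one_lt hp.rotate.one_lt hp.rotate.rotate.one_lt b2 b3
      (hp.detPoly_pos (hgpos t ht.1 (hle t ht)))
  have hMT : 0 < M T := by
    have hp := hpack T hT1
    obtain ⟨b2, b3⟩ := hp.powerCoord_nonneg hI (hneg T hT1 hT2)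
    refine hp.minorPoly_pos_of_sum_nonneg (hgpos T hT1 hT2) b2 b3 ?_
    have := hv0 T hT1
    have := hw0 T hT1
    refine nonneg_of_mul_nonneg_right (a := v T ^ 2 * w T ^ 2) ?_ (by positivity)
    refine le_of_le_of_eq hT3 ?_
    linear_combination -hfirst T hT1 - hrest T hT1
  have hcont : ContinuousOn M (Set.Icc 1 T) := by
    have cv : Continuous v := by fun_prop
    have cw : Continuous w := by fun_prop
    have k2 : ContinuousOn p2 (Set.Icc 1 T) :=
      (by fun_prop : Continuous fun t : ℝ => t * c2).continuousOn.div cv.continuousOn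
        fun t ht => (hv0 t ht.1).ne'
    have k3 : ContinuousOn p3 (Set.Icc 1 T) :=
      (by fun_prop : Continuous fun t : ℝ => t * c3).continuousOn.div cw.continuousOn
        fun t ht => (hw0 t ht.1).ne'
    have l2 : ContinuousOn q2 (Set.Icc 1 T) :=
      continuousOn_const.div cv.continuousOn fun t ht => (hv0 t ht.1).ne'
    have l3 : ContinuousOn q3 (Set.Icc 1 T) :=
      continuousOn_const.div cw.continuousOn fun t ht => (hw0 t ht.1).ne'
    have m1 : ContinuousOn D1 (Set.Icc 1 T) := (k2.mul k3).add ((continuousOn_const.mul l2).mul l3)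
    have m2 : ContinuousOn D2 (Set.Icc 1 T) :=
      (k3.mul continuousOn_const).add ((continuousOn_const.mul l3).mul continuousOn_const)
    have m3 : ContinuousOn D3 (Set.Icc 1 T) :=
      (continuousOn_const.mul k2).add (continuousOn_const.mul l2)
    clear_value D1 D2 D3 p2 p3
    simp only [hM, minorPoly, powerCoord]
    fun_prop
  have hM1 : 0 < M 1 := by
    by_contra! hn
    obtain ⟨t, ht, h0⟩ := intermediate_value_Icc hT1 hcont ⟨hn, hMT.le⟩
    exact hMne t ht h0
  simpa only [hM, hD11, hD21, hD31, hp21, hp31] using hM1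

/-- Positivity when only the first barycentric coordinate may be negative. -/
theorem triForm_pos_of_nonneg (h : IsPacking c1 c2 c3 s1 s2 s3 I1 I2 I3 C1 C2 C3)
    (hA : 0 < gramDet C1 C2 C3)
    (hw2 : 0 ≤ powerCoord C2 C3 C1 c2 c3 c1) (hw3 : 0 ≤ powerCoord C3 C1 C2 c3 c1 c2)
    {y1 y2 y3 : ℝ} (hy : ¬ (y1 = 0 ∧ y2 = 0 ∧ y3 = 0)) :
    0 < triForm C1 C2 C3 (powerCoord C1 C2 C3 c1 c2 c3 / (C1 ^ 2 - 1))
      (powerCoord C2 C3 C1 c2 c3 c1 / (C2 ^ 2 - 1))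
      (powerCoord C3 C1 C2 c3 c1 c2 / (C3 ^ 2 - 1)) y1 y2 y3 := by
  refine triForm_pos_of_minorPoly h.one_lt h.rotate.one_lt h.rotate.rotate.one_lt hw2 hw3
    (h.detPoly_pos hA) ?_ hy
  rcases lt_or_ge (powerCoord C1 C2 C3 c1 c2 c3) 0 with hw | hw
  · exact h.minorPoly_pos_of_neg hA hw
  · have := h.hc1
    have := h.hc2
    have := h.hc3
    exact h.minorPoly_pos_of_sum_nonneg hA hw2 hw3 (by positivity)

/-- Everything is invariant under rotation of the indices, which moves the only possibly negative
coordinate to the first place. -/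
theorem triForm_pos (h : IsPacking c1 c2 c3 s1 s2 s3 I1 I2 I3 C1 C2 C3)
    (hA : 0 < gramDet C1 C2 C3) {y1 y2 y3 : ℝ} (hy : ¬ (y1 = 0 ∧ y2 = 0 ∧ y3 = 0)) :
    0 < triForm C1 C2 C3 (powerCoord C1 C2 C3 c1 c2 c3 / (C1 ^ 2 - 1))
      (powerCoord C2 C3 C1 c2 c3 c1 / (C2 ^ 2 - 1))
      (powerCoord C3 C1 C2 c3 c1 c2 / (C3 ^ 2 - 1)) y1 y2 y3 := by
  rcases lt_or_ge (powerCoord C2 C3 C1 c2 c3 c1) 0 with hw2 | hw2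
  · obtain ⟨b3, b1⟩ := h.rotate.powerCoord_nonneg (h.rotate.one_lt_weight hw2) hw2.le
    rw [← triForm_rotate]
    exact h.rotate.triForm_pos_of_nonneg ((gramDet_rotate _ _ _).symm ▸ hA) b3 b1
      fun h' => hy ⟨h'.2.2, h'.1, h'.2.1⟩
  rcases lt_or_ge (powerCoord C3 C1 C2 c3 c1 c2) 0 with hw3 | hw3
  · obtain ⟨b1, b2⟩ := h.rotate.rotate.powerCoord_nonneg (h.rotate.rotate.one_lt_weight hw3) hw3.le
    rw [← triForm_rotate, ← triForm_rotate]
    exact h.rotate.rotate.triForm_pos_of_nonneg (gramDet_rotate C3 C1 C2 ▸ hA) b1 b2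
      fun h' => hy ⟨h'.2.1, h'.2.2, h'.1⟩
  · exact h.triForm_pos_of_nonneg hA hw2 hw3 hy

end IsPacking

/-! ### Hyperbolic triangles and the Gram determinant -/

open UpperHalfPlane

/-- The vertices of a nondegenerate triangle have a positive Gram determinant. -/
theorem gramDet_pos_of_isNondegenerate (T : Fin 3 → ℍ) (hT : IsNondegenerate T) :
    0 < gramDet (Real.cosh (dist (T 1) (T 2))) (Real.cosh (dist (T 2) (T 0)))
      (Real.cosh (dist (T 0) (T 1))) := by
  set M : Matrix (Fin 3) (Fin 3) ℝ :=
    Matrix.of fun i => ![(T i).re ^ 2 + (T i).im ^ 2, (T i).re, 1] with hM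
  have h0 := (T 0).im_pos
  have h1 := (T 1).im_pos
  have h2 := (T 2).im_pos
  have hdet : gramDet (Real.cosh (dist (T 1) (T 2))) (Real.cosh (dist (T 2) (T 0)))
      (Real.cosh (dist (T 0) (T 1))) =
        (M.det / (2 * (T 0).im * (T 1).im * (T 2).im)) ^ 2 := by
    simp only [gramDet, cosh_dist', Matrix.det_fin_three, hM, Matrix.of_apply]
    simp only [Matrix.cons_val_zero, Matrix.cons_val_one, Matrix.cons_val]
    field_simp
    ring
  -- A kernel vector of `M` gives an equation `v₀|z|² + v₁ Re z + v₂ = 0` satisfied by all three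
  -- vertices: a vertical line or a half-circle.
  have hne : M.det ≠ 0 := by
    intro h
    obtain ⟨v, hv, hMv⟩ := Matrix.exists_mulVec_eq_zero_iff.2 h
    have hline : ∀ i, v 0 * ((T i).re ^ 2 + (T i).im ^ 2) + v 1 * (T i).re + v 2 = 0 := by
      intro i
      have := congrFun hMv i
      simp only [Matrix.mulVec, dotProduct, Fin.sum_univ_three, hM, Matrix.of_apply, Matrix.cons_val_zero,
        Matrix.cons_val_one, Matrix.cons_val, Pi.zero_apply] at this
      linarith
    by_cases hv0 : v 0 = 0
    · have hv1 : v 1 ≠ 0 := by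
        intro hv1
        have := hline 0
        rw [hv0, hv1] at this
        refine hv (funext fun i => ?_)
        fin_cases i
        · exact hv0
        · exact hv1
        · simpa using this
      refine hT _ (Or.inl ⟨-v 2 / v 1, rfl⟩) fun i => ?_
      have := hline i
      rw [Set.mem_ofPred_eq, eq_div_iff hv1]
      rw [hv0] at this
      linarith
    · have e : ∀ i, ((T i).re - -v 1 / (2 * v 0)) ^ 2 + (T i).im ^ 2 =
          (v 1 / (2 * v 0)) ^ 2 - v 2 / v 0 := by
        intro i
        have := hline i
        field_simp
        linear_combination 4 * v 0 * this
      have hpos : 0 < (v 1 / (2 * v 0)) ^ 2 - v 2 / v 0 := by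
        rw [← e 0]
        positivity
      refine hT _ (Or.inr ⟨-v 1 / (2 * v 0), √((v 1 / (2 * v 0)) ^ 2 - v 2 / v 0),
        Real.sqrt_pos.2 hpos, rfl⟩) fun i => ?_
      rw [Set.mem_ofPred_eq, Real.sq_sqrt hpos.le]
      exact e i
  rw [hdet]
  positivity

/-- Edge lengths with a positive Gram determinant are those of a nondegenerate triangle. -/
theorem exists_triangle {C0 C1 C2 : ℝ} (h0 : 1 < C0) (h2 : 1 < C2)
    (hA : 0 < gramDet C0 C1 C2) : ∃ T : Fin 3 → ℍ, Real.cosh (dist (T 1) (T 2)) = C0 ∧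
      Real.cosh (dist (T 2) (T 0)) = C1 ∧ Real.cosh (dist (T 0) (T 1)) = C2 ∧
      IsNondegenerate T := by
  obtain ⟨S, hS, hS2⟩ : ∃ S : ℝ, 0 < S ∧ S ^ 2 = C2 ^ 2 - 1 :=
    ⟨√(C2 ^ 2 - 1), Real.sqrt_pos.2 (by nlinarith), Real.sq_sqrt (by nlinarith)⟩
  -- The vertices will be `i`, `t i` and `x + y i`, with `t` the exponential of the edge length
  -- whose cosh is `C2`.
  obtain ⟨t, ht⟩ : ∃ t, t = C2 + S := ⟨_, rfl⟩
  have ht1 : 1 < t := by linarith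
  have htt : t ^ 2 + 1 = 2 * C2 * t := by
    rw [ht]
    linear_combination hS2
  have htS : t ^ 2 - 1 = 2 * t * S := by
    rw [ht]
    linear_combination -hS2
  have hd : 0 < t * C0 - C1 := by
    have hlt : (C1 - C0 * C2) ^ 2 < (C0 * S) ^ 2 := by
      rw [mul_pow, hS2]
      unfold gramDet at hA
      nlinarith
    have := (abs_lt.1 (abs_lt_of_sq_lt_sq hlt (by positivity))).2
    rw [ht]
    linarith
  -- Subtracting the distance equations from `x + y i` to `t i` and to `i` eliminates `x` and
  -- determines `y`.
  obtain ⟨y, hy⟩ : ∃ y, y = t * S / (t * C0 - C1) := ⟨_, rfl⟩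
  have hy0 : 0 < y := by
    rw [hy]
    exact div_pos (by positivity) hd
  have hyd : y * (t * C0 - C1) = t * S := by
    rw [hy]
    field_simp
  have hx : 0 < 2 * y * C1 - 1 - y ^ 2 := by
    have e : (t * C0 - C1) ^ 2 * (2 * y * C1 - 1 - y ^ 2) = t ^ 2 * gramDet C0 C1 C2 := by
      have : (t * C0 - C1) ^ 2 * (2 * y * C1 - 1 - y ^ 2) =
        2 * (t * C0 - C1) * C1 * (y * (t * C0 - C1)) - (t * C0 - C1) ^ 2 -
          (y * (t * C0 - C1)) ^ 2 := by ring
      rw [this, hyd, gramDet]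
      linear_combination (-(t * C0 - C1) * C1) * htS - t ^ 2 * hS2 +
        (t * C0 * C1 - C1 ^ 2) * htt - (t * C0 * C1 - C1 ^ 2) * htt + t * C0 * C1 * htt
    have h' : 0 < t ^ 2 * gramDet C0 C1 C2 := by positivity
    rw [← e] at h'
    exact pos_of_mul_pos_right h' (sq_nonneg _)
  obtain ⟨x, hx0, hx2⟩ : ∃ x : ℝ, 0 < x ∧ x ^ 2 = 2 * y * C1 - 1 - y ^ 2 :=
    ⟨_, Real.sqrt_pos.2 hx, Real.sq_sqrt hx.le⟩
  have ht0 : 0 < t := by linarith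
  refine ⟨![UpperHalfPlane.mk ⟨0, 1⟩ one_pos, UpperHalfPlane.mk ⟨0, t⟩ ht0,
    UpperHalfPlane.mk ⟨x, y⟩ hy0], ?_, ?_, ?_, ?_⟩
  · simp only [Matrix.cons_val_one, Matrix.cons_val_zero, Matrix.cons_val, cosh_dist', mk_re, mk_im]
    rw [div_eq_iff (by positivity)]
    linear_combination hx2 + htS - 2 * hyd
  · simp only [Matrix.cons_val_zero, Matrix.cons_val, cosh_dist', mk_re, mk_im]
    rw [div_eq_iff (by positivity)]
    linear_combination hx2
  · simp only [Matrix.cons_val_one, Matrix.cons_val_zero, cosh_dist', mk_re, mk_im]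
    rw [div_eq_iff (by positivity)]
    linear_combination htt
  · rintro L (⟨c, rfl⟩ | ⟨c, R, hR, rfl⟩) hL
    · have a := hL 0
      have b := hL 2
      simp only [Matrix.cons_val_zero, Matrix.cons_val, Set.mem_ofPred_eq, mk_re] at a b
      linarith
    · have a := hL 0
      have b := hL 1
      simp only [Matrix.cons_val_zero, Matrix.cons_val_one, Set.mem_ofPred_eq, mk_re, mk_im] at a b
      nlinarith

/-! ### The functions of the coordinates -/

/-- The hyperbolic cosine of the radius with coordinate `x`. -/
noncomputable def coshRadius (x : ℝ) : ℝ := (1 + Real.exp x ^ 2) / (1 - Real.exp x ^ 2)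

/-- The hyperbolic sine of the radius with coordinate `x`. -/
noncomputable def sinhRadius (x : ℝ) : ℝ := 2 * Real.exp x / (1 - Real.exp x ^ 2)

section Radius

variable {x : ℝ}

theorem one_sub_exp_sq_pos (hx : x < 0) : 0 < 1 - Real.exp x ^ 2 := by
  have := Real.exp_lt_one_iff.2 hx
  have := Real.exp_pos x
  nlinarith

theorem cosh_radius (hx : x < 0) :
    Real.cosh (2 * Real.artanh (Real.exp x)) = coshRadius x := by
  have h := one_sub_exp_sq_pos hx
  have hm : Real.exp x ∈ Set.Ioo (-1 : ℝ) 1 := ⟨by linarith [Real.exp_pos x], Real.exp_lt_one_iff.2 hx⟩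
  rw [Real.cosh_two_mul, Real.cosh_artanh hm, Real.sinh_artanh hm, div_pow, div_pow,
    Real.sq_sqrt h.le, coshRadius]
  ring

theorem sinh_radius (hx : x < 0) :
    Real.sinh (2 * Real.artanh (Real.exp x)) = sinhRadius x := by
  have h := one_sub_exp_sq_pos hx
  have hm : Real.exp x ∈ Set.Ioo (-1 : ℝ) 1 := ⟨by linarith [Real.exp_pos x], Real.exp_lt_one_iff.2 hx⟩
  rw [Real.sinh_two_mul, Real.cosh_artanh hm, Real.sinh_artanh hm, sinhRadius, mul_assoc,
    div_mul_div_comm, Real.mul_self_sqrt h.le]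
  ring

theorem sinhRadius_pos (hx : x < 0) : 0 < sinhRadius x :=
  div_pos (by positivity) (one_sub_exp_sq_pos hx)

theorem coshRadius_pos (hx : x < 0) : 0 < coshRadius x :=
  div_pos (by positivity) (one_sub_exp_sq_pos hx)

theorem coshRadius_sq (hx : x < 0) : coshRadius x ^ 2 = sinhRadius x ^ 2 + 1 := by
  have := one_sub_exp_sq_pos hx
  unfold coshRadius sinhRadius
  field_simp
  ring

theorem hasDerivAt_coshRadius (hx : x < 0) : HasDerivAt coshRadius (sinhRadius x ^ 2) x := by
  have h := one_sub_exp_sq_pos hx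
  have h1 := (Real.hasDerivAt_exp x).fun_pow 2
  refine ((h1.const_add 1).fun_div (h1.const_sub 1) h.ne').congr_deriv ?_
  unfold sinhRadius
  field_simp
  ring

theorem hasDerivAt_sinhRadius (hx : x < 0) :
    HasDerivAt sinhRadius (sinhRadius x * coshRadius x) x := by
  have h := one_sub_exp_sq_pos hx
  have h1 := (Real.hasDerivAt_exp x).fun_pow 2
  refine (((Real.hasDerivAt_exp x).const_mul 2).fun_div (h1.const_sub 1) h.ne').congr_deriv ?_
  unfold sinhRadius coshRadius
  field_simp
  ring

end Radius

/-! ### Edges and angles as functions of the coordinates, and their derivatives -/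

/-- The hyperbolic cosine of the edge opposite to `i`, in terms of the coordinates. -/
noncomputable def edgeCosh (I u : Fin 3 → ℝ) (i : Fin 3) : ℝ :=
  coshRadius (u (i + 1)) * coshRadius (u (i + 2)) +
    I i * sinhRadius (u (i + 1)) * sinhRadius (u (i + 2))

theorem isPacking_edgeCosh {I u : Fin 3 → ℝ} (hI : ∀ i, -1 < I i) (hstr : StructureCondition I)
    (hu : ∀ i, u i < 0) (i : Fin 3) :
    IsPacking (coshRadius (u i)) (coshRadius (u (i + 1))) (coshRadius (u (i + 2)))
      (sinhRadius (u i)) (sinhRadius (u (i + 1))) (sinhRadius (u (i + 2)))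
      (I i) (I (i + 1)) (I (i + 2)) (edgeCosh I u i) (edgeCosh I u (i + 1))
      (edgeCosh I u (i + 2)) := by
  have e : i + 2 + 1 = i ∧ i + 2 + 2 = i + 1 ∧ i + 1 + 1 = i + 2 ∧ i + 1 + 2 = i := by
    revert i
    decide
  have g1 := hstr i
  have g2 := hstr (i + 1)
  have g3 := hstr (i + 2)
  rw [e.2.2.1, e.2.2.2] at g2
  rw [e.1, e.2.1] at g3
  refine ⟨sinhRadius_pos (hu _), sinhRadius_pos (hu _), sinhRadius_pos (hu _),
    coshRadius_pos (hu _), coshRadius_pos (hu _), coshRadius_pos (hu _), coshRadius_sq (hu _),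
    coshRadius_sq (hu _), coshRadius_sq (hu _), hI _, hI _, hI _, g1, g2, g3, rfl, ?_, ?_⟩
  · rw [edgeCosh, e.2.2.1, e.2.2.2]
  · rw [edgeCosh, e.1, e.2.1]

theorem edgeLength_radii {I u : Fin 3 → ℝ} (hu : ∀ i, u i < 0) (i : Fin 3) :
    edgeLength I (radii u) i = Real.arcosh (edgeCosh I u i) := by
  simp only [edgeLength, radii, cosh_radius (hu _), sinh_radius (hu _), edgeCosh]

/-- The angle opposite to the first edge, for given hyperbolic cosines of the edges. -/
noncomputable def cosineAngle (X Y Z : ℝ) : ℝ :=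
  Real.arccos ((Y * Z - X) * (√((Y ^ 2 - 1) * (Z ^ 2 - 1)))⁻¹)

theorem angleMap_eq_cosineAngle {I u : Fin 3 → ℝ} (hI : ∀ i, -1 < I i)
    (hstr : StructureCondition I) (hu : ∀ i, u i < 0)
    (hA : 0 < gramDet (edgeCosh I u 0) (edgeCosh I u 1) (edgeCosh I u 2)) (i : Fin 3) :
    angleMap I u i =
      cosineAngle (edgeCosh I u i) (edgeCosh I u (i + 1)) (edgeCosh I u (i + 2)) := by
  have hC : ∀ i, 1 < edgeCosh I u i := fun i => (isPacking_edgeCosh hI hstr hu i).one_lt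
  obtain ⟨T, t0, t1, t2, hT⟩ := exists_triangle (hC 0) (hC 2) hA
  have hcosh : ∀ i, Real.cosh (dist (T (i + 1)) (T (i + 2))) = edgeCosh I u i := by
    intro i
    fin_cases i
    · exact t0
    · exact t1
    · exact t2
  have hR : Realizes I (radii u) T := by
    refine ⟨fun i => ?_, hT⟩
    rw [edgeLength_radii hu, ← hcosh, Real.arcosh_cosh dist_nonneg]
  have e : i + 2 + 1 = i ∧ i + 2 + 2 = i + 1 ∧ i + 1 + 1 = i + 2 ∧ i + 1 + 2 = i := by
    revert i
    decide
  have d1 := hcosh (i + 1)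
  have d2 := hcosh (i + 2)
  rw [e.2.2.1, e.2.2.2, dist_comm] at d1
  rw [e.1, e.2.1] at d2
  have hlaw := cos_hypAngle (T i) (T (i + 1)) (T (i + 2))
  rw [d1, d2, hcosh i] at hlaw
  have s1 : 0 ≤ Real.sinh (dist (T i) (T (i + 1))) := Real.sinh_nonneg_iff.2 dist_nonneg
  have s2 : 0 ≤ Real.sinh (dist (T i) (T (i + 2))) := Real.sinh_nonneg_iff.2 dist_nonneg
  have hs : √((edgeCosh I u (i + 1) ^ 2 - 1) * (edgeCosh I u (i + 2) ^ 2 - 1)) =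
      Real.sinh (dist (T i) (T (i + 1))) * Real.sinh (dist (T i) (T (i + 2))) := by
    rw [← d1, ← d2, ← Real.sinh_sq, ← Real.sinh_sq, ← mul_pow, Real.sqrt_sq (by positivity),
      mul_comm]
  have hpos : 0 < √((edgeCosh I u (i + 1) ^ 2 - 1) * (edgeCosh I u (i + 2) ^ 2 - 1)) := by
    have h1 := hC (i + 1)
    have h2 := hC (i + 2)
    exact Real.sqrt_pos.2 (mul_pos (by nlinarith) (by nlinarith))
  rw [angleMap, innerAngle_eq I (radii u) T hR i, cosineAngle, ← div_eq_mul_inv]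
  rw [← hs] at hlaw
  have : Real.cos (hypAngle (T i) (T (i + 1)) (T (i + 2))) =
      (edgeCosh I u (i + 1) * edgeCosh I u (i + 2) - edgeCosh I u i) /
        √((edgeCosh I u (i + 1) ^ 2 - 1) * (edgeCosh I u (i + 2) ^ 2 - 1)) := by
    rw [eq_div_iff hpos.ne']
    linarith
  rw [← this]
  exact (Real.arccos_cos (InnerProductGeometry.angle_nonneg _ _)
    (InnerProductGeometry.angle_le_pi _ _)).symm

/-- The derivative of the angle in terms of the hyperbolic cosines of the edges. -/
theorem hasFDerivAt_cosineAngle {E : Type*} [NormedAddCommGroup E] [NormedSpace ℝ E]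
    {X Y Z : E → ℝ} {X' Y' Z' : E →L[ℝ] ℝ} {a : E} (hX : HasFDerivAt X X' a)
    (hY : HasFDerivAt Y Y' a) (hZ : HasFDerivAt Z Z' a) (h1 : 1 < Y a) (h2 : 1 < Z a)
    (hA : 0 < gramDet (X a) (Y a) (Z a)) :
    HasFDerivAt (fun e => cosineAngle (X e) (Y e) (Z e))
      ((√(gramDet (X a) (Y a) (Z a)))⁻¹ • (X' - ((X a * Y a - Z a) / (Y a ^ 2 - 1)) • Y' -
        ((X a * Z a - Y a) / (Z a ^ 2 - 1)) • Z')) a := by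
  have y1 : 0 < Y a ^ 2 - 1 := by nlinarith
  have z1 : 0 < Z a ^ 2 - 1 := by nlinarith
  have hq : 0 < (Y a ^ 2 - 1) * (Z a ^ 2 - 1) := mul_pos y1 z1
  obtain ⟨R, hR⟩ : ∃ R, R = √((Y a ^ 2 - 1) * (Z a ^ 2 - 1)) := ⟨_, rfl⟩
  have hR0 : 0 < R := hR ▸ Real.sqrt_pos.2 hq
  have hR2 : R ^ 2 = (Y a ^ 2 - 1) * (Z a ^ 2 - 1) := hR ▸ Real.sq_sqrt hq.le
  obtain ⟨G, hG⟩ : ∃ G, G = √(gramDet (X a) (Y a) (Z a)) := ⟨_, rfl⟩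
  have hG0 : 0 < G := hG ▸ Real.sqrt_pos.2 hA
  have hG2 : G ^ 2 = gramDet (X a) (Y a) (Z a) := hG ▸ Real.sq_sqrt hA.le
  -- `G / R` is the sine of the angle, so `gramDet > 0` keeps the argument of `arccos` away from
  -- `±1`.
  have hrel : 1 - ((Y a * Z a - X a) * R⁻¹) ^ 2 = (G / R) ^ 2 := by
    rw [gramDet] at hG2
    field_simp
    rw [hG2, hR2]
    ring
  have hρ : ((Y a * Z a - X a) * R⁻¹) ^ 2 < 1 := by
    have : 0 < (G / R) ^ 2 := by positivity
    linarith
  have hn1 : (Y a * Z a - X a) * R⁻¹ ≠ -1 := by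
    intro h
    rw [h] at hρ
    norm_num at hρ
  have hn2 : (Y a * Z a - X a) * R⁻¹ ≠ 1 := by
    intro h
    rw [h] at hρ
    norm_num at hρ
  have hnum := (hY.mul hZ).sub hX
  have hden := ((hY.pow 2).sub_const 1).mul ((hZ.pow 2).sub_const 1)
  have hsq := (((Real.hasDerivAt_sqrt hq.ne').fun_inv
    (Real.sqrt_pos.2 hq).ne').comp_hasFDerivAt_of_eq a hden rfl)
  rw [hR] at hn1 hn2
  have hcomp := (Real.hasDerivAt_arccos hn1 hn2).comp_hasFDerivAt_of_eq a (hnum.mul hsq) rfl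
  refine HasFDerivAt.congr_fderiv hcomp ?_
  rw [← hR, hrel, Real.sqrt_sq (by positivity), ← hG]
  ext e
  simp
  rw [← hR, hR2]
  field_simp
  ring

/-- In the coordinates `u` the partial derivatives become `cⱼ Cᵢ - cₖ`, the factors occurring in
`edgeDet`. -/
theorem hasFDerivAt_edgeCosh {I u : Fin 3 → ℝ} (hu : ∀ i, u i < 0) (i : Fin 3) :
    HasFDerivAt (fun v => edgeCosh I v i)
      ((coshRadius (u (i + 1)) * edgeCosh I u i - coshRadius (u (i + 2))) •
          ContinuousLinearMap.proj (R := ℝ) (φ := fun _ : Fin 3 => ℝ) (i + 1) +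
        (coshRadius (u (i + 2)) * edgeCosh I u i - coshRadius (u (i + 1))) •
          ContinuousLinearMap.proj (R := ℝ) (φ := fun _ : Fin 3 => ℝ) (i + 2)) u := by
  have p : ∀ j : Fin 3, HasFDerivAt (fun v : Fin 3 → ℝ => v j)
      (ContinuousLinearMap.proj (R := ℝ) (φ := fun _ : Fin 3 => ℝ) j) u :=
    fun j => hasFDerivAt_apply j u
  have hc := fun j => (hasDerivAt_coshRadius (hu j)).comp_hasFDerivAt_of_eq u (p j) rfl
  have hs := fun j => (hasDerivAt_sinhRadius (hu j)).comp_hasFDerivAt_of_eq u (p j) rfl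
  refine HasFDerivAt.congr_fderiv (((hc (i + 1)).mul (hc (i + 2))).add
    (((hs (i + 1)).const_mul (I i)).mul (hs (i + 2)))) ?_
  have e1 := coshRadius_sq (hu (i + 1))
  have e2 := coshRadius_sq (hu (i + 2))
  ext e
  simp [edgeCosh]
  linear_combination (-(coshRadius (u (i + 2)) * e (i + 1))) * e1 -
    coshRadius (u (i + 1)) * e (i + 2) * e2


/-! ### The Jacobian matrix -/

open Filter Topology

theorem uCoord_neg {r : Fin 3 → ℝ} (hr : ∀ i, 0 < r i) (i : Fin 3) : uCoord r i < 0 := by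
  have h : 0 < r i / 2 := by linarith [hr i]
  refine Real.log_neg ?_ (Real.tanh_lt_one _)
  rw [Real.tanh_eq_sinh_div_cosh]
  exact div_pos (Real.sinh_pos_iff.2 h) (Real.cosh_pos _)

theorem gramDet_edgeCosh_rotate (I u : Fin 3 → ℝ) (i : Fin 3) :
    gramDet (edgeCosh I u i) (edgeCosh I u (i + 1)) (edgeCosh I u (i + 2)) =
      gramDet (edgeCosh I u 0) (edgeCosh I u 1) (edgeCosh I u 2) := by
  fin_cases i
  · rfl
  · exact gramDet_rotate _ _ _
  · exact (gramDet_rotate _ _ _).symm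

theorem gramDet_edgeCosh_pos {I r : Fin 3 → ℝ} (hI : ∀ i, -1 < I i)
    (hstr : StructureCondition I) (hr : r ∈ admissibleSpace I) :
    0 < gramDet (edgeCosh I (uCoord r) 0) (edgeCosh I (uCoord r) 1)
      (edgeCosh I (uCoord r) 2) := by
  obtain ⟨hr0, T, hT, hnd⟩ := hr
  have hu := uCoord_neg hr0
  have h : ∀ i, Real.cosh (dist (T (i + 1)) (T (i + 2))) = edgeCosh I (uCoord r) i := by
    intro i
    have e := edgeLength_radii (I := I) hu i
    rw [radii_uCoord r hr0] at e
    rw [hT i, e, Real.cosh_arcosh (isPacking_edgeCosh hI hstr hu i).one_lt.le]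
  have h0 := h 0
  have h1 := h 1
  have h2 := h 2
  have := gramDet_pos_of_isNondegenerate T hnd
  rw [← h0, ← h1, ← h2]
  exact this

/-- The coefficients of the quadratic form of the Jacobian. -/
noncomputable def jacobianCoeff (I u : Fin 3 → ℝ) (i : Fin 3) : ℝ :=
  powerCoord (edgeCosh I u i) (edgeCosh I u (i + 1)) (edgeCosh I u (i + 2))
    (coshRadius (u i)) (coshRadius (u (i + 1))) (coshRadius (u (i + 2))) /
      (edgeCosh I u i ^ 2 - 1)

/-- `gramDet > 0` is an open condition sufficient for a triangle to exist, so `angleMap` agrees near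
the point with `cosineAngle` of the edges and the chain rule applies. The formula displays the rows
of the matrix of `triForm`. -/
theorem exists_hasFDerivAt_angleMap {I r : Fin 3 → ℝ} (hI : ∀ i, -1 < I i)
    (hstr : StructureCondition I) (hr : r ∈ admissibleSpace I) :
    ∃ L : (Fin 3 → ℝ) →L[ℝ] (Fin 3 → ℝ), HasFDerivAt (angleMap I) L (uCoord r) ∧
      ∀ y i, L y i = -(√(gramDet (edgeCosh I (uCoord r) 0) (edgeCosh I (uCoord r) 1)
        (edgeCosh I (uCoord r) 2)))⁻¹ *
          ((jacobianCoeff I (uCoord r) (i + 1) * edgeCosh I (uCoord r) (i + 1) +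
            jacobianCoeff I (uCoord r) (i + 2) * edgeCosh I (uCoord r) (i + 2)) * y i -
            jacobianCoeff I (uCoord r) (i + 2) * y (i + 1) -
            jacobianCoeff I (uCoord r) (i + 1) * y (i + 2)) := by
  have hu := uCoord_neg hr.1
  have hA := gramDet_edgeCosh_pos hI hstr hr
  generalize uCoord r = u at *
  have hC : ∀ i, 1 < edgeCosh I u i := fun i => (isPacking_edgeCosh hI hstr hu i).one_lt
  have hd := hasFDerivAt_edgeCosh (I := I) hu
  have hneg : ∀ᶠ v in 𝓝 u, ∀ i, v i < 0 :=
    eventually_all.2 fun i => (continuous_apply i).continuousAt.eventually_lt_const (hu i)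
  have hgram : ∀ᶠ v in 𝓝 u, 0 < gramDet (edgeCosh I v 0) (edgeCosh I v 1) (edgeCosh I v 2) := by
    have h0 := (hd 0).continuousAt
    have h1 := (hd 1).continuousAt
    have h2 := (hd 2).continuousAt
    have hc : ContinuousAt
        (fun v => gramDet (edgeCosh I v 0) (edgeCosh I v 1) (edgeCosh I v 2)) u := by
      unfold gramDet
      fun_prop
    exact hc.eventually (lt_mem_nhds hA)
  have hcomp := fun i => hasFDerivAt_cosineAngle (hd i) (hd (i + 1)) (hd (i + 2)) (hC _) (hC _)
    ((gramDet_edgeCosh_rotate I u i).symm ▸ hA)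
  refine ⟨_, (hasFDerivAt_pi.2 hcomp).congr_of_eventuallyEq ?_, ?_⟩
  · filter_upwards [hneg, hgram] with v hv hg
    funext i
    exact angleMap_eq_cosineAngle hI hstr hv hg i
  · intro y i
    have e : i + 2 + 1 = i ∧ i + 2 + 2 = i + 1 ∧ i + 1 + 1 = i + 2 ∧ i + 1 + 2 = i := by
      revert i
      decide
    have q1 : edgeCosh I u (i + 1) ^ 2 - 1 ≠ 0 := by nlinarith [hC (i + 1)]
    have q2 : edgeCosh I u (i + 2) ^ 2 - 1 ≠ 0 := by nlinarith [hC (i + 2)]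
    simp only [ContinuousLinearMap.coe_pi', smul_apply,
      sub_apply, add_apply, ContinuousLinearMap.proj_apply,
      smul_eq_mul, gramDet_edgeCosh_rotate, e.1, e.2.1, e.2.2.1, e.2.2.2, jacobianCoeff,
      powerCoord]
    rw [neg_mul, ← mul_neg]
    congr 1
    field_simp
    ring

theorem posDef_neg_angleJacobian {I r : Fin 3 → ℝ} (hI : ∀ i, -1 < I i)
    (hstr : StructureCondition I) (hr : r ∈ admissibleSpace I) :
    (-(angleJacobian I r)).PosDef := by
  obtain ⟨L, hL, hLy⟩ := exists_hasFDerivAt_angleMap hI hstr hr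
  have hA := gramDet_edgeCosh_pos hI hstr hr
  have hJ : angleJacobian I r = LinearMap.toMatrix' (L : (Fin 3 → ℝ) →ₗ[ℝ] (Fin 3 → ℝ)) := by
    rw [angleJacobian, hL.fderiv]
  refine Matrix.PosDef.of_dotProduct_mulVec_pos ?_ fun y hy => ?_
  · ext i j
    rw [hJ]
    simp only [Matrix.conjTranspose_apply, Matrix.neg_apply, LinearMap.toMatrix'_apply,
      ContinuousLinearMap.coe_coe, hLy, star_trivial]
    fin_cases i <;> fin_cases j <;> simp
  · have hform := (isPacking_edgeCosh hI hstr (uCoord_neg hr.1) 0).triForm_pos hA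
      (y1 := y 0) (y2 := y 1) (y3 := y 2) (by
        rintro ⟨a, b, c⟩
        refine hy (funext fun i => ?_)
        fin_cases i
        · exact a
        · exact b
        · exact c)
    have hG := inv_pos.2 (Real.sqrt_pos.2 hA)
    refine lt_of_lt_of_eq (mul_pos hG hform) ?_
    rw [Matrix.neg_mulVec, hJ, LinearMap.toMatrix'_mulVec]
    simp only [star_trivial, dotProduct, Fin.sum_univ_three, Pi.neg_apply,
      ContinuousLinearMap.coe_coe, hLy]
    simp only [triForm, jacobianCoeff, Fin.isValue, zero_add, show (1 : Fin 3) + 1 = 2 from rfl,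
      show (1 : Fin 3) + 2 = 0 from rfl, show (2 : Fin 3) + 1 = 0 from rfl,
      show (2 : Fin 3) + 2 = 1 from rfl]
    ring

end HypInversive

theorem mainTheorem5 (I r : Fin 3 → ℝ) (hI : ∀ i, -1 < I i)
    (hstr : HypInversive.StructureCondition I) (hr : r ∈ HypInversive.admissibleSpace I) :
    DifferentiableAt ℝ (HypInversive.angleMap I) (HypInversive.uCoord r) ∧
      (-(HypInversive.angleJacobian I r)).PosDef := by
  obtain ⟨L, hL, -⟩ := HypInversive.exists_hasFDerivAt_angleMap hI hstr hr
  exact ⟨hL.differentiableAt, HypInversive.posDef_neg_angleJacobian hI hstr hr⟩
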